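/- Let $X$ be a compact metric space, $T:X\to X$ a continuous map, $d\ge 1$, and $\vec\varphi=(\varphi_1,\dots,\varphi_d)$ continuous functions $X\to\mathbb R$. Let $\mathrm{Prob}(T)$ be the set of $T$-invariant Borel probability measures with the weak-$*$ topology, $h(T,\mu)$ the Kolmogorov–Sinai entropy, $\mu(\vec\varphi)=(\int\varphi_1\,d\mu,\dots,\int\varphi_d\,d\mu)$, $\rho=\{\mu(\vec\varphi):\mu\in\mathrm{Prob}(T)\}$ the rotation set, $$\mathsf h(z)=\sup\{h(T,\mu):\mu\in\mathrm{Prob}(T),\ \mu(\vec\varphi)=z\}\quad(\sup\varnothing=-\infty),\qquad \mathsf P(y)=\sup_{\mu\in\mathrm{Prob}(T)}\big(h(T,\mu)+\mu(y\cdot\vec\varphi)\big),\qquad y\cdot\vec\varphi=\sum_i y_i\varphi_i .$$ A linear equilibrium measure of a potential $\psi$ is a $\mu\in\mathrm{Prob}(T)$ achieving $\sup_{\mathrm{Prob}(T)}(h(T,\mu)+\mu(\psi))$. Let $r\in\{1,2,\dots\}\cup\{\infty,\omega\}$. Assume that $(T,\vec\varphi)$ is a $C^r$ Legendre system: $\rho$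 has nonempty interior, $T$ has finite topological entropy, and $\mathsf h$ is concave of $C^r$ Legendre type, i.e. $\mathsf h:\mathbb R^d\to\mathbb R\cup\{-\infty\}$ is upper semicontinuous and concave; the interior of its domain $\{\mathsf h\text{ finite}\}$ is nonempty and there $\mathsf h$ is strictly concave and $C^r$, with negative definite Hessian if $r\ge2$; and $|\nabla\mathsf h(x_i)|\to\infty$ whenever interior points $x_i$ of the domain converge to a boundary point of it. Then $\mathsf P$ is finite and differentiable on $\mathbb R^d$, $-\mathsf h(z)=\sup_y(\langle y,z\rangle-\mathsf P(y))$ for every $z \in \mathbb R^d$, and the following hold. (A) Let $F:U\to\mathbb R$ be $C^r$ on an open set $U\supset\rho$. Let $\mathcal V$ be the set of points of $\rho$ at which $\mathsf h+F$ attains its maximum over $\rho$, and $\mathcal Y=-\nabla\mathsf h(\mathcal V)$. Then $\mathcal V$ is nonempty, compact and contained in the interior of $\rho$; $\nabla F+\nabla\mathsf h=0$ on $\mathcal V$; $\mathcal Y$ is nonempty and compact, and $\mathcal Y=(\nabla\mathsf P)^{-1}(\mathcal V)$. The nonlinear equilibrium measures, i.e. the maximizers of $h(T,\mu)+F(\mu(\vec\varphi))$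 over $\mathrm{Prob}(T)$, are exactly the linear equilibrium measures of the potentials $y\cdot\vec\varphi$, $y\in\mathcal Y$. (B) More generally, let $G:V\to\mathbb R$, $G=G(z_0;z)$, be $C^r$ with $\partial_0G>0$ on an open set $V\subset\mathbb R\times\mathbb R^d$ that contains all points $(h(T,\mu);\mu(\vec\varphi))$, $\mu\in\mathrm{Prob}(T)$, and the closure of the graph $\{(\mathsf h(z);z):z\in\rho\}$. (The condition on the graph follows from the first one when $\mathsf h$ is continuous on $\rho$ and the suprema defining $\mathsf h(z)$, $z\in\rho$, are attained.) Let $\mathcal V$ be the set of points $z\in\rho$ at which $z\mapsto G(\mathsf h(z);z)$ attains its maximum over $\rho$, and $\mathcal Y=-\nabla\mathsf h(\mathcal V)$. Then $\mathcal V$ is nonempty, compact and contained in the interior of $\rho$, and $\nabla G+\partial_0G\cdot\nabla\mathsf h=0$ on $\mathcal V$, where $\nabla G=(\partial_1G,\dots,\partial_dG)$ and the derivatives of $G$ are taken at $(\mathsf h(z);z)$. The set $\mathcal Y$ is nonempty and compact, and $\mathcal Y=(\nabla\mathsf P)^{-1}(\mathcal V)$. The set $\mathcal{EM}$ of nonlinear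 equilibrium measures, i.e. of maximizers of $G(h(T,\mu);\mu(\vec\varphi))$ over $\mathrm{Prob}(T)$, is exactly the set of all linear equilibrium measures of the potentials $y\cdot\vec\varphi$, $y\in\mathcal Y$. Moreover: - if each $y\cdot\vec\varphi$ with $y\in\mathcal Y$ has a linear equilibrium measure, then $\mathcal{EM}\neq\varnothing$ and $\mathcal V=\{\mu(\vec\varphi):\mu\in\mathcal{EM}\}$; - if for every $y\in\mathbb R^d$ there is exactly one linear equilibrium measure $\nu_y$ of $y\cdot\vec\varphi$, then $\mathcal{EM}=\{\nu_y:y\in\mathcal Y\}$; - if $\mu\mapsto h(T,\mu)$ is upper semicontinuous on $\mathrm{Prob}(T)$, then $\mathcal{EM}$ is nonempty and compact, and $\mathcal V=\{\mu(\vec\varphi):\mu\in\mathcal{EM}\}$. -/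

import Mathlib

open MeasureTheory

noncomputable section

namespace NonlinearFormalism

/-! ### Kolmogorov-Sinai entropy

A finite measurable partition is encoded by a measurable map `f : X → Fin k`
(its atoms are the fibres of `f`, some of which may be empty). -/

/-- Shannon entropy `H_μ` of the partition into the fibres of `f`. -/
def partitionEntropy {X ι : Type*} [MeasurableSpace X] [Fintype ι]
    (μ : Measure X) (f : X → ι) : ℝ :=
  ∑ i, Real.negMulLog (μ.real (f ⁻¹' {i}))

/-- The map whose fibres are the atoms of the `n`-th join
`α ∨ T⁻¹ α ∨ ⋯ ∨ T^{-(n-1)} α` of the partition `α` given by `f`. -/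
def itinerary {X ι : Type*} (T : X → X) (f : X → ι) (n : ℕ) : X → (Fin n → ι) :=
  fun x i => f (T^[(i : ℕ)] x)

/-- Entropy `h(T, μ, α) = lim (1 / n) H_μ(α ∨ ⋯ ∨ T^{-(n-1)} α)` of `T` relative to the partition
given by `f` (the limit exists when `μ` is invariant, and then equals the upper limit). -/
def entropyOfPartition {X : Type*} [MeasurableSpace X] (T : X → X) (μ : Measure X) {k : ℕ}
    (f : X → Fin k) : EReal :=
  Filter.limsup (fun n : ℕ => ((partitionEntropy μ (itinerary T f n) / n : ℝ) : EReal))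
    Filter.atTop

/-- The Kolmogorov-Sinai entropy `h(T, μ)`: supremum over all finite measurable partitions. -/
def ksEntropy {X : Type*} [MeasurableSpace X] (T : X → X) (μ : Measure X) : EReal :=
  ⨆ (k : ℕ) (f : X → Fin k) (_ : Measurable f), entropyOfPartition T μ f

/-! ### Invariant measures, linear pressure and linear equilibrium measures -/

/-- `Prob(T)`: the `T`-invariant Borel probability measures. -/
def invariantMeasures {X : Type*} [MeasurableSpace X] (T : X → X) :
    Set (ProbabilityMeasure X) :=
  {μ | MeasurePreserving T (μ : Measure X) (μ : Measure X)}

/-- The pressure `h(T, μ) + ∫ ψ dμ` of a measure. -/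
def pressureOfMeasure {X : Type*} [MeasurableSpace X] (T : X → X) (ψ : X → ℝ)
    (μ : ProbabilityMeasure X) : EReal :=
  ksEntropy T (μ : Measure X) + ((∫ x, ψ x ∂(μ : Measure X) : ℝ) : EReal)

/-- The linear pressure of the potential `ψ`. -/
def linearPressure {X : Type*} [MeasurableSpace X] (T : X → X) (ψ : X → ℝ) : EReal :=
  ⨆ μ ∈ invariantMeasures T, pressureOfMeasure T ψ μ

/-- The linear equilibrium measures of the potential `ψ`: the invariant probability measures that
achieve the supremum defining the pressure. -/
def linearEquilibriumMeasures {X : Type*} [MeasurableSpace X] (T : X → X) (ψ : X → ℝ) :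
    Set (ProbabilityMeasure X) :=
  {μ | μ ∈ invariantMeasures T ∧ pressureOfMeasure T ψ μ = linearPressure T ψ}

/-! ### Several potentials -/

/-- The potential `y · φ = ∑ i, y i * φ i`. -/
def dotPotential {X : Type*} [TopologicalSpace X] {d : ℕ} (φ : Fin d → C(X, ℝ))
    (y : EuclideanSpace ℝ (Fin d)) : X → ℝ :=
  fun x => ∑ i, y i * φ i x

/-- The vector `μ(φ) = (∫ φ₁ dμ, …, ∫ φ_d dμ)`. -/
def meanVector {X : Type*} [TopologicalSpace X] [MeasurableSpace X] {d : ℕ}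
    (φ : Fin d → C(X, ℝ)) (μ : ProbabilityMeasure X) : EuclideanSpace ℝ (Fin d) :=
  WithLp.toLp 2 (fun i => ∫ x, φ i x ∂(μ : Measure X))

/-- The rotation set `ρ(φ) = {μ(φ) : μ ∈ Prob(T)}`. -/
def rotationSet {X : Type*} [TopologicalSpace X] [MeasurableSpace X] {d : ℕ} (T : X → X)
    (φ : Fin d → C(X, ℝ)) : Set (EuclideanSpace ℝ (Fin d)) :=
  meanVector φ '' invariantMeasures T

/-- The finite-dimensional entropy function
`𝗁(z) = sup {h(T, μ) : μ ∈ Prob(T), μ(φ) = z}`, with `sup ∅ = -∞`. -/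
def entropyFn {X : Type*} [TopologicalSpace X] [MeasurableSpace X] {d : ℕ} (T : X → X)
    (φ : Fin d → C(X, ℝ)) (z : EuclideanSpace ℝ (Fin d)) : EReal :=
  ⨆ μ ∈ {μ : ProbabilityMeasure X | μ ∈ invariantMeasures T ∧ meanVector φ μ = z},
    ksEntropy T (μ : Measure X)

/-- The real-valued version of `𝗁`, meaningful where `𝗁` is finite. -/
def entropyFnReal {X : Type*} [TopologicalSpace X] [MeasurableSpace X] {d : ℕ} (T : X → X)
    (φ : Fin d → C(X, ℝ)) (z : EuclideanSpace ℝ (Fin d)) : ℝ :=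
  (entropyFn T φ z).toReal

/-- The finite-dimensional pressure function `𝖯(y) = sup_μ h(T, μ) + μ(y · φ)`. -/
def pressureFn {X : Type*} [TopologicalSpace X] [MeasurableSpace X] {d : ℕ} (T : X → X)
    (φ : Fin d → C(X, ℝ)) (y : EuclideanSpace ℝ (Fin d)) : EReal :=
  linearPressure T (dotPotential φ y)

/-- The real-valued version of `𝖯`. -/
def pressureFnReal {X : Type*} [TopologicalSpace X] [MeasurableSpace X] {d : ℕ} (T : X → X)
    (φ : Fin d → C(X, ℝ)) (y : EuclideanSpace ℝ (Fin d)) : ℝ :=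
  (pressureFn T φ y).toReal

/-! ### Legendre type and Legendre systems -/

/-- The effective domain: the points where `f` is finite. -/
def effectiveDomain {E : Type*} (f : E → EReal) : Set E :=
  {x | f x ≠ ⊥ ∧ f x ≠ ⊤}

/-- `f : ℝᵈ → ℝ ∪ {-∞}` is concave of `C^r` Legendre type. Here `r` is a natural number, `∞`
(smooth) or `ω` (real-analytic). -/
structure IsConcaveLegendreType {d : ℕ} (r : WithTop ℕ∞)
    (f : EuclideanSpace ℝ (Fin d) → EReal) : Prop where
  /-- `f` takes its values in `ℝ ∪ {-∞}` -/
  ne_top : ∀ x, f x ≠ ⊤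
  upperSemicontinuous : UpperSemicontinuous f
  concave : ConcaveOn ℝ (effectiveDomain f) (fun x => (f x).toReal)
  interior_nonempty : (interior (effectiveDomain f)).Nonempty
  strictConcave : StrictConcaveOn ℝ (interior (effectiveDomain f)) (fun x => (f x).toReal)
  contDiff : ContDiffOn ℝ r (fun x => (f x).toReal) (interior (effectiveDomain f))
  /-- if `r ≥ 2`, the Hessian is negative definite on the interior of the domain -/
  hessian_neg : 2 ≤ r → ∀ x ∈ interior (effectiveDomain f), ∀ v, v ≠ 0 →
    iteratedFDeriv ℝ 2 (fun x => (f x).toReal) x ![v, v] < 0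
  /-- the gradient blows up at the boundary of the domain -/
  gradient_blowup : ∀ u : ℕ → EuclideanSpace ℝ (Fin d),
    (∀ i, u i ∈ interior (effectiveDomain f)) →
    ∀ x ∈ frontier (effectiveDomain f), Filter.Tendsto u Filter.atTop (nhds x) →
    Filter.Tendsto (fun i => ‖gradient (fun x => (f x).toReal) (u i)‖) Filter.atTop Filter.atTop

/-- `(T, φ)` is a `C^r` Legendre system. -/
structure IsLegendreSystem {X : Type*} [MetricSpace X] [MeasurableSpace X] {d : ℕ}
    (r : WithTop ℕ∞) (T : X → X) (φ : Fin d → C(X, ℝ)) : Prop where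
  continuous : Continuous T
  interior_nonempty : (interior (rotationSet T φ)).Nonempty
  /-- the topological entropy of `T` is finite -/
  entropy_lt_top : Dynamics.coverEntropy T Set.univ < ⊤
  legendre : IsConcaveLegendreType r (entropyFn T φ)

/-! ### Fully nonlinear pressures -/

/-- The point `(h(T, μ); μ(φ))` of `ℝ × ℝᵈ`. -/
def entropyMean {X : Type*} [TopologicalSpace X] [MeasurableSpace X] {d : ℕ} (T : X → X)
    (φ : Fin d → C(X, ℝ)) (μ : ProbabilityMeasure X) : ℝ × EuclideanSpace ℝ (Fin d) :=
  ((ksEntropy T (μ : Measure X)).toReal, meanVector φ μ)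

/-- The nonlinear equilibrium measures: the invariant probability measures that maximize
`G(h(T, μ); μ(φ))`. -/
def nonlinearEquilibriumMeasures {X : Type*} [TopologicalSpace X] [MeasurableSpace X] {d : ℕ}
    (T : X → X) (φ : Fin d → C(X, ℝ)) (G : ℝ × EuclideanSpace ℝ (Fin d) → ℝ) :
    Set (ProbabilityMeasure X) :=
  {μ | μ ∈ invariantMeasures T ∧
    ∀ ν ∈ invariantMeasures T, G (entropyMean T φ ν) ≤ G (entropyMean T φ μ)}

/-- The point `(𝗁(z); z)` of the graph of the entropy function. -/
def graphPoint {X : Type*} [TopologicalSpace X] [MeasurableSpace X] {d : ℕ} (T : X → X)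
    (φ : Fin d → C(X, ℝ)) (z : EuclideanSpace ℝ (Fin d)) : ℝ × EuclideanSpace ℝ (Fin d) :=
  (entropyFnReal T φ z, z)

/-- The set `𝒱` of points `z` of the rotation set at which `G(𝗁(z); z)` is maximal. -/
def maximizers {X : Type*} [TopologicalSpace X] [MeasurableSpace X] {d : ℕ}
    (T : X → X) (φ : Fin d → C(X, ℝ)) (G : ℝ × EuclideanSpace ℝ (Fin d) → ℝ) :
    Set (EuclideanSpace ℝ (Fin d)) :=
  {z | z ∈ rotationSet T φ ∧
    ∀ w ∈ rotationSet T φ, G (graphPoint T φ w) ≤ G (graphPoint T φ z)}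

/-- The set `𝒴 = -∇𝗁(𝒱)`. -/
def slopes {X : Type*} [TopologicalSpace X] [MeasurableSpace X] {d : ℕ}
    (T : X → X) (φ : Fin d → C(X, ℝ)) (G : ℝ × EuclideanSpace ℝ (Fin d) → ℝ) :
    Set (EuclideanSpace ℝ (Fin d)) :=
  (fun z => -gradient (entropyFnReal T φ) z) '' maximizers T φ G

/-- The partial derivative `∂₀G` in the entropy variable. -/
def partialZero {d : ℕ} (G : ℝ × EuclideanSpace ℝ (Fin d) → ℝ)
    (p : ℝ × EuclideanSpace ℝ (Fin d)) : ℝ :=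
  deriv (fun t => G (t, p.2)) p.1

/-- The gradient `∇G = (∂₁G, …, ∂_dG)` in the remaining variables. -/
def spatialGradient {d : ℕ} (G : ℝ × EuclideanSpace ℝ (Fin d) → ℝ)
    (p : ℝ × EuclideanSpace ℝ (Fin d)) : EuclideanSpace ℝ (Fin d) :=
  gradient (fun w => G (p.1, w)) p.2

/-- The function `G(z₀; z) = z₀ + F(z)` associated with the energy `F(μ(φ))`. -/
def ofEnergy {d : ℕ} (F : EuclideanSpace ℝ (Fin d) → ℝ) :
    ℝ × EuclideanSpace ℝ (Fin d) → ℝ :=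
  fun p => p.1 + F p.2

end NonlinearFormalism

end

open NonlinearFormalism

/-! Write `H` for the entropy function on the compact convex rotation set `ρ`. Gradient blow-up
means that at a boundary point `H` rises with infinite slope towards the interior
(`IsLegendreOn.mem_interior_of_eventually_le`). As `∂₀G > 0`, this gain beats any linear loss in
`z`, so maximizers of `G (H z, z)` are interior (`graphMaximizers_subset_interior`) and satisfy the
first-order condition.

`H` is only upper semicontinuous on `ρ`, so `G` is maximized over the compact closure of the graph.
This closure lies below the graph and contains the vertical segments from its points up to the graph
(`mem_closure_valueGraph_of_mem_Icc`). Since `G` increases along them, the maximum is attained on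
the graph.

For a tilt `H + ⟪y, ·⟫` the maximizer is interior, and unique by strict concavity. It inverts `-∇H`
and, by an envelope argument, is the gradient of the conjugate `tiltSup`, which is the pressure.
Hence `𝒴 = (∇𝖯)⁻¹(𝒱)`.

Equilibrium measures of both kinds satisfy `h(T, μ) = H(μ(φ))`; beyond that, the linear ones for `y`
are singled out by `μ(φ) = ∇𝖯(y)`, the nonlinear ones by `μ(φ) ∈ 𝒱`. The nonlinear half needs `G` to
increase from `(h(T, μ), z)` to `(H z, z)`. The segment between them lies in `V` because entropy
takes all intermediate values along mixtures of measures (`exists_ksEntropy_mixMeasure_eq`). -/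

namespace NonlinearFormalism

open MeasureTheory Filter Topology Set

/-! ### Functions of Legendre type: boundary behaviour, closure of the graph, tilts. -/

section ConvexAnalysis

/-- A concave function on a segment that is upper semicontinuous at the endpoints is continuous. -/
theorem _root_.ConcaveOn.continuousOn_Icc_of_upperSemicontinuousWithinAt {g : ℝ → ℝ}
    (hg : ConcaveOn ℝ (Icc 0 1) g) (hu₀ : UpperSemicontinuousWithinAt g (Icc 0 1) 0)
    (hu₁ : UpperSemicontinuousWithinAt g (Icc 0 1) 1) : ContinuousOn g (Icc 0 1) := by
  -- Lying above the chord gives lower semicontinuity at the endpoints, so only the upper half must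
  -- be assumed there.
  have chord : ∀ s ∈ Icc (0 : ℝ) 1, (1 - s) * g 0 + s * g 1 ≤ g s := by
    intro s hs
    have := hg.2 (left_mem_Icc.2 zero_le_one) (right_mem_Icc.2 zero_le_one)
      (sub_nonneg.2 hs.2) hs.1 (by ring)
    simpa using this
  have hcont : Continuous fun s : ℝ => (1 - s) * g 0 + s * g 1 := by fun_prop
  intro t ht
  rcases eq_or_lt_of_le ht.1 with rfl | h0
  · refine continuousWithinAt_iff_lower_upperSemicontinuousWithinAt.2 ⟨?_, hu₀⟩
    intro a ha
    have : ∀ᶠ s in 𝓝 (0 : ℝ), a < (1 - s) * g 0 + s * g 1 :=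
      hcont.continuousAt.eventually_const_lt (by simpa using ha)
    filter_upwards [mem_nhdsWithin_of_mem_nhds this, self_mem_nhdsWithin] with s h1 h2
    exact h1.trans_le (chord s h2)
  rcases eq_or_lt_of_le ht.2 with rfl | h1
  · refine continuousWithinAt_iff_lower_upperSemicontinuousWithinAt.2 ⟨?_, hu₁⟩
    intro a ha
    have : ∀ᶠ s in 𝓝 (1 : ℝ), a < (1 - s) * g 0 + s * g 1 :=
      hcont.continuousAt.eventually_const_lt (by simpa using ha)
    filter_upwards [mem_nhdsWithin_of_mem_nhds this, self_mem_nhdsWithin] with s h1 h2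
    exact h1.trans_le (chord s h2)
  · have := hg.continuousOn_interior
    rw [interior_Icc] at this
    exact (this.continuousAt (Ioo_mem_nhds h0 h1)).continuousWithinAt

variable {E : Type*} [NormedAddCommGroup E] [InnerProductSpace ℝ E] [CompleteSpace E]

/-- The supergradient inequality. -/
theorem _root_.ConcaveOn.le_add_inner_gradient {s : Set E} {f : E → ℝ} (hf : ConcaveOn ℝ s f)
    {x u : E} (hx : x ∈ s) (hu : u ∈ s) (hd : DifferentiableAt ℝ f x) :
    f u ≤ f x + inner ℝ (gradient f x) (u - x) := by
  have hc : ConcaveOn ℝ (AffineMap.lineMap (k := ℝ) x u ⁻¹' s)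
      (f ∘ AffineMap.lineMap (k := ℝ) x u) := hf.comp_affineMap _
  have hder : HasDerivAt (f ∘ AffineMap.lineMap (k := ℝ) x u)
      (inner ℝ (gradient f x) (u - x)) 0 := by
    have h1 : HasDerivAt (AffineMap.lineMap (k := ℝ) x u) (u - x) 0 :=
      AffineMap.hasDerivAt_lineMap
    have h2 : HasFDerivAt f (fderiv ℝ f x) (AffineMap.lineMap (k := ℝ) x u 0) := by
      simpa using hd.hasFDerivAt
    have := h2.comp_hasDerivAt (0 : ℝ) h1
    rwa [inner_gradient_left]
  have := hc.slope_le_of_hasDerivAt (x := 0) (y := 1) (by simpa using hx) (by simpa using hu)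
    zero_lt_one hder
  simp only [slope_def_field, Function.comp_apply, AffineMap.lineMap_apply_one,
    AffineMap.lineMap_apply_zero, sub_zero, div_one] at this
  linarith

/-- A nonnegative concave upper semicontinuous function of Legendre type on a compact set. -/
structure IsLegendreOn (ρ : Set E) (H : E → ℝ) : Prop where
  isCompact : IsCompact ρ
  usc : UpperSemicontinuousOn H ρ
  concave : ConcaveOn ℝ ρ H
  nonneg : ∀ x ∈ ρ, 0 ≤ H x
  interior_nonempty : (interior ρ).Nonempty
  strictConcave : StrictConcaveOn ℝ (interior ρ) H
  contDiffOn : ContDiffOn ℝ 1 H (interior ρ)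
  blowup : ∀ u : ℕ → E, (∀ i, u i ∈ interior ρ) → ∀ x ∈ frontier ρ, Tendsto u atTop (𝓝 x) →
    Tendsto (fun i => ‖gradient H (u i)‖) atTop atTop

/-- The function `H + ⟪y, ·⟫`. -/
def tilt (H : E → ℝ) (y w : E) : ℝ := H w + inner ℝ y w

/-- The graph of `H` over `ρ`, with the value as first coordinate. -/
def valueGraph (ρ : Set E) (H : E → ℝ) : Set (ℝ × E) := (fun z => (H z, z)) '' ρ

namespace IsLegendreOn

variable {ρ : Set E} {H : E → ℝ} (h : IsLegendreOn ρ H)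
include h

theorem nonempty : ρ.Nonempty := h.interior_nonempty.mono interior_subset

theorem exists_bound : ∃ M, ∀ x ∈ ρ, H x ≤ M := by
  obtain ⟨a, -, ha⟩ := h.usc.exists_isMaxOn h.nonempty h.isCompact
  exact ⟨H a, fun x hx => ha hx⟩

theorem differentiableAt {x : E} (hx : x ∈ interior ρ) : DifferentiableAt ℝ H x :=
  (h.contDiffOn.contDiffAt (isOpen_interior.mem_nhds hx)).differentiableAt one_ne_zero

theorem continuousAt {x : E} (hx : x ∈ interior ρ) : ContinuousAt H x :=
  (h.differentiableAt hx).continuousAt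

theorem continuousOn_gradient : ContinuousOn (gradient H) (interior ρ) := by
  have := h.contDiffOn.continuousOn_fderiv_of_isOpen isOpen_interior le_rfl
  exact (InnerProductSpace.toDual ℝ E).symm.continuous.comp_continuousOn this

theorem le_add_inner {x u : E} (hx : x ∈ interior ρ) (hu : u ∈ ρ) :
    H u ≤ H x + inner ℝ (gradient H x) (u - x) :=
  h.concave.le_add_inner_gradient (interior_subset hx) hu (h.differentiableAt hx)

theorem segment_mem_interior {w x₀ : E} (hw : w ∈ ρ) (hx₀ : x₀ ∈ interior ρ) {t : ℝ}
    (ht : t ∈ Ioc (0 : ℝ) 1) : w + t • (x₀ - w) ∈ interior ρ :=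
  h.concave.1.add_smul_sub_mem_interior' (subset_closure hw) hx₀ ht

/-- If `H` grows at most linearly along a segment from `w` to an interior point,
then `w` is an interior point. -/
theorem mem_interior_of_eventually_le {w x₀ : E} (hw : w ∈ ρ) (hx₀ : x₀ ∈ interior ρ) (C : ℝ)
    (hC : ∀ᶠ t in 𝓝[>] (0 : ℝ), H (w + t • (x₀ - w)) - H w ≤ C * t) : w ∈ interior ρ := by
  by_contra hwi
  have hfr : w ∈ frontier ρ := by
    rw [h.isCompact.isClosed.frontier_eq]; exact ⟨hw, hwi⟩
  obtain ⟨M, hM⟩ := h.exists_bound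
  obtain ⟨δ, hδ, hball⟩ := Metric.nhds_basis_closedBall.mem_iff.1
    (isOpen_interior.mem_nhds hx₀)
  have ht0 : Tendsto (fun n : ℕ => 1 / ((n : ℝ) + 1)) atTop (𝓝 0) :=
    tendsto_one_div_add_atTop_nhds_zero_nat
  have htpos : ∀ n : ℕ, 0 < 1 / ((n : ℝ) + 1) := fun n => by positivity
  have htle : ∀ n : ℕ, 1 / ((n : ℝ) + 1) ≤ 1 := fun n => by
    rw [div_le_one (by positivity)]; linarith [n.cast_nonneg (α := ℝ)]
  have hint : ∀ n : ℕ, w + (1 / ((n : ℝ) + 1)) • (x₀ - w) ∈ interior ρ := fun n =>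
    h.segment_mem_interior hw hx₀ ⟨htpos n, htle n⟩
  have hlim : Tendsto (fun n : ℕ => w + (1 / ((n : ℝ) + 1)) • (x₀ - w)) atTop (𝓝 w) := by
    simpa using tendsto_const_nhds.add (ht0.smul_const (x₀ - w))
  have hblow := h.blowup _ hint w hfr hlim
  have hev := (tendsto_nhdsWithin_iff.2 ⟨ht0, Eventually.of_forall htpos⟩).eventually hC
  obtain ⟨n, hn1, hn2⟩ := (hev.and (hblow.eventually_gt_atTop ((M + |C|) / δ))).exists
  set t : ℝ := 1 / ((n : ℝ) + 1)
  have htp : 0 < t := htpos n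
  have ht1 : t ≤ 1 := htle n
  set x := w + t • (x₀ - w) with hx
  set g := gradient H x
  -- The supergradient inequality at `x`, tested at `w`, bounds the component of `g` along `x₀ - w`
  -- independently of `n`.
  have hgC : inner ℝ g (x₀ - w) ≤ C := by
    have h1 := h.le_add_inner (hint n) hw
    have h2 : w - x = -(t • (x₀ - w)) := by rw [hx]; abel
    change H w ≤ H x + inner ℝ g (w - x) at h1
    rw [h2, inner_neg_right, inner_smul_right] at h1
    have : t * inner ℝ g (x₀ - w) ≤ t * C := by linarith
    exact le_of_mul_le_mul_left this htp
  -- Now test at distance `δ` from `x₀`, against the gradient (at `x₀` itself if `g = 0`, as `δ / 0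
  -- = 0`). The outcome `0 ≤ M + |C| - δ * ‖g‖` contradicts the blow-up.
  have hu : x₀ - (δ / ‖g‖) • g ∈ ρ := by
    refine interior_subset (hball ?_)
    rw [Metric.mem_closedBall, dist_eq_norm, sub_sub_cancel_left, norm_neg, norm_smul,
      Real.norm_of_nonneg (by positivity)]
    rcases eq_or_ne ‖g‖ 0 with h0 | h0
    · simp [h0, hδ.le]
    · rw [div_mul_cancel₀ _ h0]
  have h3 := h.le_add_inner (hint n) hu
  have h4 : x₀ - (δ / ‖g‖) • g - x = (1 - t) • (x₀ - w) - (δ / ‖g‖) • g := by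
    rw [hx, sub_smul, one_smul]; abel
  change _ ≤ H x + inner ℝ g (x₀ - (δ / ‖g‖) • g - x) at h3
  have h5 : (δ / ‖g‖) * inner ℝ g g = δ * ‖g‖ := by
    rw [real_inner_self_eq_norm_sq]
    rcases eq_or_ne ‖g‖ 0 with h0 | h0
    · simp [h0]
    · field_simp
  rw [h4, inner_sub_right, inner_smul_right, inner_smul_right, h5] at h3
  have h6 := h.nonneg _ hu
  have h7 := hM x (interior_subset (hint n))
  have h8 : (1 - t) * inner ℝ g (x₀ - w) ≤ |C| := by
    calc (1 - t) * inner ℝ g (x₀ - w) ≤ (1 - t) * |C| :=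
          mul_le_mul_of_nonneg_left (hgC.trans (le_abs_self C)) (by linarith)
      _ ≤ 1 * |C| := mul_le_mul_of_nonneg_right (by linarith) (abs_nonneg C)
      _ = |C| := one_mul _
  have h9 : M + |C| < ‖g‖ * δ := (div_lt_iff₀ hδ).1 hn2
  linarith

/-- `H` may be discontinuous on `ρ` at the boundary, but not along segments; this supplies the
intermediate values and boundary limits used below. -/
theorem continuousOn_segment {z w : E} (hz : z ∈ ρ) (hw : w ∈ ρ) :
    ContinuousOn (fun t : ℝ => H (AffineMap.lineMap z w t)) (Icc 0 1) := by
  have hsub : MapsTo (AffineMap.lineMap (k := ℝ) z w) (Icc 0 1) ρ := fun t ht =>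
    h.concave.1.lineMap_mem hz hw ht
  have hu : UpperSemicontinuousOn (fun t : ℝ => H (AffineMap.lineMap z w t)) (Icc 0 1) :=
    h.usc.comp (AffineMap.lineMap_continuous (R := ℝ)).continuousOn hsub
  refine ConcaveOn.continuousOn_Icc_of_upperSemicontinuousWithinAt ?_
    (hu 0 (by simp)) (hu 1 (by simp))
  exact (h.concave.comp_affineMap (AffineMap.lineMap (k := ℝ) z w)).subset hsub
    (convex_Icc 0 1)

/-- Upper semicontinuity on a closed set makes the hypograph closed, and it contains the graph. -/
theorem mem_and_le_of_mem_closure_valueGraph {s : ℝ} {z : E}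
    (hs : (s, z) ∈ closure (valueGraph ρ H)) : z ∈ ρ ∧ s ≤ H z := by
  have hcl := (upperSemicontinuousOn_iff_isClosed_hypograph h.isCompact.isClosed).1 h.usc
  have hcl' := hcl.preimage (continuous_swap (X := ℝ) (Y := E))
  refine closure_minimal ?_ hcl' hs
  rintro _ ⟨w, hw, rfl⟩
  exact ⟨hw, le_rfl⟩

/-- The closure of the graph contains, above each point, every vertical segment ending on the
graph and starting in the closure. -/
theorem mem_closure_valueGraph_of_mem_Icc {s t : ℝ} {z : E}
    (hs : (s, z) ∈ closure (valueGraph ρ H)) (ht : t ∈ Icc s (H z)) :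
    (t, z) ∈ closure (valueGraph ρ H) := by
  have hz := (h.mem_and_le_of_mem_closure_valueGraph hs).1
  rcases eq_or_lt_of_le ht.1 with rfl | hst
  · exact hs
  refine Metric.mem_closure_iff.2 fun ε hε => ?_
  -- A graph point near `(s, z)` lies over some `w` with `H w ≤ t ≤ H z`. The value `t` is then
  -- taken on the segment from `w` to `z`, which stays close to `z`.
  obtain ⟨_, ⟨w, hw, rfl⟩, hdist⟩ := Metric.mem_closure_iff.1 hs (min ε (t - s))
    (lt_min hε (sub_pos.2 hst))
  rw [Prod.dist_eq, max_lt_iff] at hdist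
  have h1 : H w ≤ t := by
    have := (hdist.1.trans_le (min_le_right _ _))
    rw [dist_comm, Real.dist_eq] at this
    linarith [le_abs_self (H w - s)]
  have h2 : dist z w < ε := hdist.2.trans_le (min_le_left _ _)
  obtain ⟨τ, hτ, hτt⟩ := intermediate_value_Icc zero_le_one (h.continuousOn_segment hw hz)
    (show t ∈ Icc (H (AffineMap.lineMap w z (0 : ℝ))) (H (AffineMap.lineMap w z (1 : ℝ))) by
      simpa using ⟨h1, ht.2⟩)
  refine ⟨_, ⟨AffineMap.lineMap w z τ, h.concave.1.lineMap_mem hw hz hτ, rfl⟩, ?_⟩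
  change H (AffineMap.lineMap w z τ) = t at hτt
  simp only [Prod.dist_eq, hτt, dist_self, max_lt_iff]
  refine ⟨hε, lt_of_le_of_lt ?_ h2⟩
  rw [dist_comm, dist_lineMap_right, dist_comm z w, Real.norm_of_nonneg (by linarith [hτ.2])]
  exact mul_le_of_le_one_left dist_nonneg (by linarith [hτ.1])

theorem isCompact_closure_valueGraph : IsCompact (closure (valueGraph ρ H)) := by
  obtain ⟨M, hM⟩ := h.exists_bound
  refine (isCompact_Icc (a := (0 : ℝ)) (b := M)).prod h.isCompact |>.closure_of_subset ?_
  rintro _ ⟨w, hw, rfl⟩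
  exact ⟨⟨h.nonneg w hw, hM w hw⟩, hw⟩

/-! ### Tilted maximizers and the conjugate function -/

theorem upperSemicontinuousOn_tilt (y : E) : UpperSemicontinuousOn (tilt H y) ρ :=
  h.usc.add
    ((innerSL ℝ y).continuous.upperSemicontinuous.upperSemicontinuousOn ρ)

/-- Maximality of the tilt bounds the growth of `H` along inward segments by a linear function,
which is impossible at the boundary. -/
theorem mem_interior_of_isMaxOn_tilt {y z : E} (hz : z ∈ ρ) (hm : IsMaxOn (tilt H y) ρ z) :
    z ∈ interior ρ := by
  obtain ⟨x₀, hx₀⟩ := h.interior_nonempty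
  refine h.mem_interior_of_eventually_le hz hx₀ (-inner ℝ y (x₀ - z)) ?_
  filter_upwards [Ioc_mem_nhdsGT (zero_lt_one (α := ℝ))] with t ht
  have h1 : tilt H y _ ≤ tilt H y z := hm (interior_subset (h.segment_mem_interior hz hx₀ ht))
  simp only [tilt, inner_add_right, inner_smul_right] at h1
  linarith

theorem strictConcaveOn_tilt (y : E) : StrictConcaveOn ℝ (interior ρ) (tilt H y) :=
  h.strictConcave.add_concaveOn ((innerₛₗ ℝ y).concaveOn h.strictConcave.1)

/-- Strict concavity is available only on the interior, so both maximizers are placed there first.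
-/
theorem eq_of_isMaxOn_tilt {y z w : E} (hz : z ∈ ρ) (hzm : IsMaxOn (tilt H y) ρ z)
    (hw : w ∈ ρ) (hwm : IsMaxOn (tilt H y) ρ w) : z = w :=
  (h.strictConcaveOn_tilt y).eq_of_isMaxOn (hzm.on_subset interior_subset)
    (hwm.on_subset interior_subset) (h.mem_interior_of_isMaxOn_tilt hz hzm)
    (h.mem_interior_of_isMaxOn_tilt hw hwm)

theorem isMaxOn_tilt_iff {y z : E} (hz : z ∈ interior ρ) :
    IsMaxOn (tilt H y) ρ z ↔ y = -gradient H z := by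
  constructor
  · intro hm
    have hloc : IsLocalMax (tilt H y) z := hm.isLocalMax (mem_interior_iff_mem_nhds.1 hz)
    have h1 : HasGradientAt H (gradient H z) z := (h.differentiableAt hz).hasGradientAt
    have h2 : HasFDerivAt (tilt H y)
        (InnerProductSpace.toDual ℝ E (gradient H z) + innerSL ℝ y) z :=
      h1.hasFDerivAt.add (innerSL ℝ y).hasFDerivAt
    have h3 := hloc.hasFDerivAt_eq_zero h2
    refine eq_neg_of_add_eq_zero_right (ext_inner_right ℝ fun v => ?_)
    have := congrArg (fun L => L v) h3
    simpa [inner_add_left] using this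
  · rintro rfl u hu
    have := h.le_add_inner hz hu
    simp only [tilt, mem_ofPred_eq, inner_neg_left, inner_sub_right] at this ⊢
    linarith

theorem exists_isMaxOn_tilt (y : E) : ∃ z ∈ ρ, IsMaxOn (tilt H y) ρ z :=
  (h.upperSemicontinuousOn_tilt y).exists_isMaxOn h.nonempty h.isCompact

end IsLegendreOn
end ConvexAnalysis

/-! ### Differentiability of the conjugate, duality, and maximization of `G` on the graph. -/

section ConvexAnalysis

variable {E : Type*} [NormedAddCommGroup E] [InnerProductSpace ℝ E] [CompleteSpace E]

/-- The convex conjugate `y ↦ sup_{w ∈ ρ} (H w + ⟪y, w⟫)`. -/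
noncomputable def tiltSup (ρ : Set E) (H : E → ℝ) (y : E) : ℝ := sSup (tilt H y '' ρ)

namespace IsLegendreOn

variable {ρ : Set E} {H : E → ℝ} (h : IsLegendreOn ρ H)

/-- The maximizer of `H + ⟪y, ·⟫` over `ρ`. -/
noncomputable def argmax (y : E) : E := (h.exists_isMaxOn_tilt y).choose

theorem argmax_mem (y : E) : h.argmax y ∈ ρ := (h.exists_isMaxOn_tilt y).choose_spec.1

theorem isMaxOn_argmax (y : E) : IsMaxOn (tilt H y) ρ (h.argmax y) :=
  (h.exists_isMaxOn_tilt y).choose_spec.2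

theorem argmax_mem_interior (y : E) : h.argmax y ∈ interior ρ :=
  h.mem_interior_of_isMaxOn_tilt (h.argmax_mem y) (h.isMaxOn_argmax y)

theorem eq_argmax {y z : E} (hz : z ∈ ρ) (hm : IsMaxOn (tilt H y) ρ z) : z = h.argmax y :=
  h.eq_of_isMaxOn_tilt hz hm (h.argmax_mem y) (h.isMaxOn_argmax y)

theorem eq_neg_gradient_argmax (y : E) : y = -gradient H (h.argmax y) :=
  (h.isMaxOn_tilt_iff (h.argmax_mem_interior y)).1 (h.isMaxOn_argmax y)

theorem argmax_neg_gradient {z : E} (hz : z ∈ interior ρ) : h.argmax (-gradient H z) = z :=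
  (h.eq_argmax (interior_subset hz) ((h.isMaxOn_tilt_iff hz).2 rfl)).symm

theorem tiltSup_eq (y : E) : tiltSup ρ H y = tilt H y (h.argmax y) :=
  IsGreatest.csSup_eq ⟨mem_image_of_mem _ (h.argmax_mem y), by
    rintro _ ⟨w, hw, rfl⟩
    exact h.isMaxOn_argmax y hw⟩

include h in
theorem tilt_le_tiltSup (y : E) {w : E} (hw : w ∈ ρ) : tilt H y w ≤ tiltSup ρ H y := by
  rw [h.tiltSup_eq]; exact h.isMaxOn_argmax y hw

theorem tilt_eq_tiltSup_iff {y w : E} (hw : w ∈ ρ) :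
    tilt H y w = tiltSup ρ H y ↔ w = h.argmax y := by
  constructor
  · intro he
    refine h.eq_argmax hw fun u hu => ?_
    change tilt H y u ≤ tilt H y w
    rw [he]
    exact h.tilt_le_tiltSup y hu
  · rintro rfl
    exact (h.tiltSup_eq y).symm

/-- By compactness it suffices to exclude a cluster point `z` other than the maximizer `w`. The gap
in tilt is `3 * ε`; upper semicontinuity at `z` and continuity of the pairing cost `ε` each, so `w`
would beat the maximizer for a nearby slope. -/
theorem continuous_argmax : Continuous h.argmax := by
  refine continuous_iff_continuousAt.2 fun y => ?_
  refine h.isCompact.tendsto_nhds_of_unique_mapClusterPt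
    (Eventually.of_forall h.argmax_mem) fun z hz hcl => ?_
  by_contra hne
  set w := h.argmax y with hw
  have hlt : tilt H y z < tilt H y w := by
    refine lt_of_le_of_ne (h.isMaxOn_argmax y hz) fun he => hne ?_
    rw [← h.tiltSup_eq] at he
    exact (h.tilt_eq_tiltSup_iff hz).1 he
  simp only [tilt] at hlt
  set ε := (H w + inner ℝ y w - (H z + inner ℝ y z)) / 3 with hε
  have hεp : 0 < ε := by rw [hε]; linarith
  have h1 : ∀ᶠ u in 𝓝[ρ] z, H u < H z + ε := h.usc z hz _ (by linarith)
  have h2 : ∀ᶠ p : E × E in 𝓝 (y, z), inner ℝ p.1 (p.2 - w) < inner ℝ y (z - w) + ε := by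
    have : Continuous fun p : E × E => (inner ℝ p.1 (p.2 - w) : ℝ) := by fun_prop
    exact this.continuousAt.eventually_lt_const (by simpa using hεp)
  rw [nhds_prod_eq] at h2
  obtain ⟨pa, hpa, pb, hpb, hp⟩ := eventually_prod_iff.1 h2
  have h3 := hcl.frequently ((eventually_nhdsWithin_iff.1 h1).and hpb)
  obtain ⟨y', ⟨h4, h5⟩, h6⟩ := (h3.and_eventually hpa).exists
  have h7 := h4 (h.argmax_mem y')
  have h8 := hp h6 h5
  have h9 : tilt H y' w ≤ tilt H y' (h.argmax y') :=
    h.isMaxOn_argmax y' (h.argmax_mem y)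
  simp only [tilt, inner_sub_right] at h8 h9
  linarith

/-- The conjugate is differentiable and its gradient is the maximizer. -/
theorem hasGradientAt_tiltSup (y : E) : HasGradientAt (tiltSup ρ H) (h.argmax y) y := by
  rw [hasGradientAt_iff_isLittleO, Asymptotics.isLittleO_iff]
  intro c hc
  filter_upwards [Metric.tendsto_nhds.1 h.continuous_argmax.continuousAt c hc] with y' hy'
  -- Testing each maximizer in the other problem traps the remainder between `0` and `⟪argmax y' -
  -- argmax y, y' - y⟫`, which is small by continuity of `argmax`.
  have h1 := h.tilt_le_tiltSup y' (h.argmax_mem y)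
  have h2 := h.tilt_le_tiltSup y (h.argmax_mem y')
  have h3 : (inner ℝ (h.argmax y' - h.argmax y) (y' - y) : ℝ) ≤ c * ‖y' - y‖ := by
    refine (real_inner_le_norm _ _).trans (mul_le_mul_of_nonneg_right ?_ (norm_nonneg _))
    rw [← dist_eq_norm]; exact hy'.le
  rw [h.tiltSup_eq y] at h2 ⊢
  rw [h.tiltSup_eq y'] at h1 ⊢
  simp only [tilt] at h1 h2 ⊢
  simp only [inner_sub_left, inner_sub_right] at h3 ⊢
  rw [real_inner_comm y (h.argmax y), real_inner_comm y' (h.argmax y),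
    real_inner_comm y (h.argmax y'), real_inner_comm y' (h.argmax y')] at *
  rw [Real.norm_eq_abs, abs_le]
  have := mul_nonneg hc.le (norm_nonneg (y' - y))
  constructor <;> linarith

theorem gradient_tiltSup (y : E) : gradient (tiltSup ρ H) y = h.argmax y :=
  (h.hasGradientAt_tiltSup y).gradient

include h in
theorem image_neg_gradient_eq_preimage {S : Set E} (hS : S ⊆ interior ρ) :
    (fun z => -gradient H z) '' S = gradient (tiltSup ρ H) ⁻¹' S := by
  ext y
  simp only [mem_image, mem_preimage, h.gradient_tiltSup]
  constructor
  · rintro ⟨z, hz, rfl⟩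
    rwa [h.argmax_neg_gradient (hS hz)]
  · intro hy
    exact ⟨_, hy, (h.eq_neg_gradient_argmax y).symm⟩

include h in
/-- Duality at the points of the domain. -/
theorem exists_tiltSup_le {z : E} (hz : z ∈ ρ) {t : ℝ} (ht : H z < t) :
    ∃ y, tiltSup ρ H y ≤ inner ℝ y z + t := by
  have hconv : Convex ℝ {p : E × ℝ | p.1 ∈ ρ ∧ p.2 ≤ H p.1} := h.concave.convex_hypograph
  have hcl := (upperSemicontinuousOn_iff_isClosed_hypograph h.isCompact.isClosed).1 h.usc
  obtain ⟨f, u, hf, hu⟩ := geometric_hahn_banach_closed_point hconv hcl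
    (x := (z, t)) (fun hm => absurd hm.2 (not_le.2 ht))
  -- The vertical component of the separating functional. It is positive since `(z, H z)` and `(z,
  -- t)` are separated, so the hyperplane is a graph and its slope gives `y`.
  set c := f (0, 1) with hc
  have hsplit : ∀ (w : E) (s : ℝ), f (w, s) = f (w, 0) + c * s := by
    intro w s
    have : (w, s) = (w, (0 : ℝ)) + s • ((0 : E), (1 : ℝ)) := by simp
    rw [this, map_add, map_smul, smul_eq_mul, mul_comm]
  have hcpos : 0 < c := by
    have h1 := hf (z, H z) ⟨hz, le_rfl⟩
    rw [hsplit] at h1 hu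
    have : 0 < c * (t - H z) := by linarith
    exact pos_of_mul_pos_left this (sub_pos.2 ht).le
  set v := (InnerProductSpace.toDual ℝ E).symm (f.comp (ContinuousLinearMap.inl ℝ E ℝ)) with hv
  have hvw : ∀ w, inner ℝ v w = f (w, 0) := fun w => by simp [hv]
  refine ⟨c⁻¹ • (v), ?_⟩
  rw [h.tiltSup_eq]
  set w := h.argmax (c⁻¹ • v)
  have h1 := hf (w, H w) ⟨h.argmax_mem _, le_rfl⟩
  rw [hsplit] at h1 hu
  simp only [tilt, real_inner_smul_left, hvw]
  have h2 : c⁻¹ * (f (w, 0) + c * H w) ≤ c⁻¹ * (f (z, 0) + c * t) :=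
    mul_le_mul_of_nonneg_left (by linarith) (inv_pos.2 hcpos).le
  rw [mul_add, mul_add, inv_mul_cancel_left₀ hcpos.ne', inv_mul_cancel_left₀ hcpos.ne'] at h2
  linarith

include h in
/-- Duality outside of the domain. -/
theorem exists_tiltSup_le_of_notMem {z : E} (hz : z ∉ ρ) (t : ℝ) :
    ∃ y, tiltSup ρ H y ≤ inner ℝ y z + t := by
  obtain ⟨M, hM⟩ := h.exists_bound
  obtain ⟨f, u, hf, hu⟩ := geometric_hahn_banach_closed_point h.concave.1
    h.isCompact.isClosed hz
  set v := (InnerProductSpace.toDual ℝ E).symm f with hv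
  have hvw : ∀ w, inner ℝ v w = f w := fun w => by simp [hv]
  -- Scaling the separating direction by `k` makes the separation gap equal to `|M - t|`, enough to
  -- absorb the bound `M` on `H`.
  set k := |M - t| / (f z - u) with hk
  have hpos : 0 < f z - u := sub_pos.2 hu
  have hk0 : 0 ≤ k := by positivity
  refine ⟨k • v, ?_⟩
  rw [h.tiltSup_eq]
  set w := h.argmax (k • v)
  have h1 := hf w (h.argmax_mem _)
  have h2 := hM w (h.argmax_mem _)
  simp only [tilt, real_inner_smul_left, hvw]
  have h3 : k * (f z - u) = |M - t| := by rw [hk]; field_simp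
  have h4 : k * f w ≤ k * u := mul_le_mul_of_nonneg_left h1.le hk0
  linarith [le_abs_self (M - t)]

end IsLegendreOn

/-! ### Maximization of nonlinear functions of the value and the point -/

section

variable {F : Type*} [NormedAddCommGroup F] [NormedSpace ℝ F]

/-- `G` is `C¹` on the open set `V` and strictly increasing in its first variable there. -/
structure IsMonotoneEnergy (V : Set (ℝ × F)) (G : ℝ × F → ℝ) : Prop where
  isOpen : IsOpen V
  contDiffOn : ContDiffOn ℝ 1 G V
  deriv_pos : ∀ p ∈ V, 0 < deriv (fun t => G (t, p.2)) p.1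

/-- Vertical slices of `V` need not be connected, so each use must show that the segment lies in
`V`; both intermediate value arguments serve this purpose. -/
theorem IsMonotoneEnergy.strictMonoOn {V : Set (ℝ × F)} {G : ℝ × F → ℝ}
    (hG : IsMonotoneEnergy V G) {s t : ℝ} {z : F} (hV : ∀ a ∈ Icc s t, (a, z) ∈ V) :
    StrictMonoOn (fun a => G (a, z)) (Icc s t) := by
  refine strictMonoOn_of_deriv_pos (convex_Icc s t) (fun a ha => ?_) fun a ha => ?_
  · exact (differentiableAt_of_deriv_ne_zero (hG.deriv_pos _ (hV a ha)).ne').continuousAt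
      |>.continuousWithinAt
  · exact hG.deriv_pos _ (hV a (interior_subset ha))

theorem IsMonotoneEnergy.hasFDerivAt {V : Set (ℝ × F)} {G : ℝ × F → ℝ}
    (hG : IsMonotoneEnergy V G) {p : ℝ × F} (hp : p ∈ V) : HasFDerivAt G (fderiv ℝ G p) p :=
  ((hG.contDiffOn.contDiffAt (hG.isOpen.mem_nhds hp)).differentiableAt one_ne_zero).hasFDerivAt

theorem IsMonotoneEnergy.fderiv_inl {V : Set (ℝ × F)} {G : ℝ × F → ℝ}
    (hG : IsMonotoneEnergy V G) {p : ℝ × F} (hp : p ∈ V) :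
    fderiv ℝ G p (1, 0) = deriv (fun t => G (t, p.2)) p.1 := by
  have h1 : HasDerivAt (fun t : ℝ => (t, p.2)) ((1 : ℝ), (0 : F)) p.1 :=
    (hasDerivAt_id p.1).prodMk (hasDerivAt_const _ _)
  exact ((hG.hasFDerivAt hp).comp_hasDerivAt p.1 h1).deriv.symm

end

theorem IsMonotoneEnergy.inner_gradient {V : Set (ℝ × E)} {G : ℝ × E → ℝ}
    (hG : IsMonotoneEnergy V G) {p : ℝ × E} (hp : p ∈ V) (v : E) :
    inner ℝ (gradient (fun w => G (p.1, w)) p.2) v = fderiv ℝ G p (0, v) := by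
  have h1 : HasFDerivAt (fun w : E => (p.1, w)) (ContinuousLinearMap.inr ℝ ℝ E) p.2 :=
    hasFDerivAt_prodMk_right p.1 p.2
  have h2 := (hG.hasFDerivAt hp).comp p.2 h1
  rw [inner_gradient_left]
  have h3 := h2.fderiv
  change fderiv ℝ (fun w => G (p.1, w)) p.2 = _ at h3
  rw [h3]
  simp

/-- The points of `ρ` at which `G (H z, z)` is maximal over `ρ`. -/
def graphMaximizers (ρ : Set E) (H : E → ℝ) (G : ℝ × E → ℝ) : Set E :=
  {z | z ∈ ρ ∧ ∀ w ∈ ρ, G (H w, w) ≤ G (H z, z)}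

namespace IsLegendreOn

variable {ρ : Set E} {H : E → ℝ} (h : IsLegendreOn ρ H) {V : Set (ℝ × E)} {G : ℝ × E → ℝ}
  (hG : IsMonotoneEnergy V G) (hV : closure (valueGraph ρ H) ⊆ V)
include h hG hV

theorem le_of_mem_closure_valueGraph {s : ℝ} {z : E}
    (hs : (s, z) ∈ closure (valueGraph ρ H)) : G (s, z) ≤ G (H z, z) := by
  have hsz := (h.mem_and_le_of_mem_closure_valueGraph hs).2
  exact (hG.strictMonoOn fun a ha => hV (h.mem_closure_valueGraph_of_mem_Icc hs ha)).monotoneOn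
    (left_mem_Icc.2 hsz) (right_mem_Icc.2 hsz) hsz

/-- Lifting a maximum `(s, z)` over the compact closure to `(H z, z)` cannot decrease `G`. -/
theorem exists_isMaxOn_closure : ∃ z ∈ graphMaximizers ρ H G,
    ∀ p ∈ closure (valueGraph ρ H), G p ≤ G (H z, z) := by
  have hne : (closure (valueGraph ρ H)).Nonempty := (h.nonempty.image _).closure
  obtain ⟨⟨s, z⟩, hsz, hmax⟩ := h.isCompact_closure_valueGraph.exists_isMaxOn hne
    (hG.contDiffOn.continuousOn.mono hV)
  have h1 : ∀ p ∈ closure (valueGraph ρ H), G p ≤ G (H z, z) := fun p hp =>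
    (hmax hp).trans (h.le_of_mem_closure_valueGraph hG hV hsz)
  exact ⟨z, ⟨(h.mem_and_le_of_mem_closure_valueGraph hsz).1, fun w hw =>
    h1 _ (subset_closure ⟨w, hw, rfl⟩)⟩, h1⟩

theorem graphMaximizers_nonempty : (graphMaximizers ρ H G).Nonempty :=
  let ⟨z, hz, _⟩ := h.exists_isMaxOn_closure hG hV
  ⟨z, hz⟩

/-- By the same lifting, the maximizers are the projection of a compact superlevel set of `G` in the
closure of the graph. -/
theorem isCompact_graphMaximizers : IsCompact (graphMaximizers ρ H G) := by
  obtain ⟨z₀, hz₀, hmax⟩ := h.exists_isMaxOn_closure hG hV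
  have hcont : ContinuousOn G (closure (valueGraph ρ H)) := hG.contDiffOn.continuousOn.mono hV
  have hcl : IsClosed (closure (valueGraph ρ H) ∩ G ⁻¹' Ici (G (H z₀, z₀))) :=
    hcont.preimage_isClosed_of_isClosed isClosed_closure isClosed_Ici
  have hK : IsCompact (closure (valueGraph ρ H) ∩ G ⁻¹' Ici (G (H z₀, z₀))) :=
    h.isCompact_closure_valueGraph.of_isClosed_subset hcl inter_subset_left
  convert hK.image continuous_snd using 1
  ext z
  constructor
  · intro hz
    exact ⟨(H z, z), ⟨subset_closure ⟨z, hz.1, rfl⟩, hz.2 _ hz₀.1⟩, rfl⟩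
  · rintro ⟨⟨s, z'⟩, ⟨hs, hge⟩, rfl⟩
    refine ⟨(h.mem_and_le_of_mem_closure_valueGraph hs).1, fun w hw => ?_⟩
    exact (hz₀.2 w hw).trans (le_trans hge (h.le_of_mem_closure_valueGraph hG hV hs))

/-- Expand `G` to first order along the inward path on the graph. As the coefficient `a` of the
increment `D` of `H` is positive, maximality forces `D` to be at most linear in `t`. -/
theorem graphMaximizers_subset_interior : graphMaximizers ρ H G ⊆ interior ρ := by
  rintro w ⟨hw, hmax⟩
  obtain ⟨x₀, hx₀⟩ := h.interior_nonempty
  set v := x₀ - w with hv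
  have hpV : (H w, w) ∈ V := hV (subset_closure ⟨w, hw, rfl⟩)
  set L := fderiv ℝ G (H w, w) with hL
  set a := L (1, 0) with ha
  have hapos : 0 < a := by
    rw [ha, hL, hG.fderiv_inl hpV]; exact hG.deriv_pos _ hpV
  have hLsplit : ∀ (D t : ℝ), L (D, t • v) = a * D + t * L (0, v) := by
    intro D t
    have : (D, t • v) = D • ((1 : ℝ), (0 : E)) + t • ((0 : ℝ), v) := by simp
    rw [this, map_add, map_smul, map_smul, smul_eq_mul, smul_eq_mul, mul_comm]
  have hlo := (hG.hasFDerivAt hpV).isLittleO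
  rw [Asymptotics.isLittleO_iff] at hlo
  -- An error of size `a / 2` leaves half of the main term `a * D`.
  have hev := hlo (half_pos hapos)
  have hpath : Tendsto (fun t : ℝ => (H (w + t • v), w + t • v)) (𝓝[>] 0) (𝓝 (H w, w)) := by
    have h1 := (h.continuousOn_segment hw (interior_subset hx₀)) 0 (by simp)
    have h2 : Tendsto (fun t : ℝ => H (AffineMap.lineMap w x₀ t)) (𝓝[>] 0) (𝓝 (H w)) := by
      have := h1.tendsto.mono_left (nhdsWithin_mono (0 : ℝ) Ioc_subset_Icc_self)
      rw [nhdsWithin_Ioc_eq_nhdsGT zero_lt_one] at this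
      simpa using this
    have h3 : ∀ t : ℝ, AffineMap.lineMap w x₀ t = w + t • v := fun t => by
      rw [AffineMap.lineMap_apply_module', add_comm]
    simp only [h3] at h2
    refine h2.prodMk_nhds ?_
    have : Continuous fun t : ℝ => w + t • v := by fun_prop
    simpa using (this.tendsto 0).mono_left nhdsWithin_le_nhds
  refine h.mem_interior_of_eventually_le hw hx₀ (2 / a * (|L (0, v)| + a / 2 * ‖v‖)) ?_
  filter_upwards [hpath.eventually hev, Ioc_mem_nhdsGT (zero_lt_one (α := ℝ))] with t ht1 ht
  have h1 := hmax _ (interior_subset (h.segment_mem_interior hw hx₀ ht))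
  set D := H (w + t • v) - H w with hD
  have hsub : (H (w + t • v), w + t • v) - (H w, w) = (D, t • v) := by
    simp [hD]
  rw [hsub, hLsplit] at ht1
  change D ≤ _
  have hnorm : ‖(D, t • v)‖ ≤ |D| + t * ‖v‖ := by
    rw [Prod.norm_mk, norm_smul, Real.norm_of_nonneg ht.1.le, Real.norm_eq_abs]
    have := mul_nonneg ht.1.le (norm_nonneg v)
    exact max_le (by linarith) (by linarith [abs_nonneg D])
  have h2 := (abs_le.1 (Real.norm_eq_abs _ ▸ ht1)).1
  have h3 : a / 2 * ‖(D, t • v)‖ ≤ a / 2 * (|D| + t * ‖v‖) :=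
    mul_le_mul_of_nonneg_left hnorm (half_pos hapos).le
  change G (H (w + t • v), w + t • v) ≤ _ at h1
  have hLabs : -(t * |L (0, v)|) ≤ t * L (0, v) := by
    have := mul_le_mul_of_nonneg_left (neg_abs_le (L (0, v))) ht.1.le
    linarith
  have hRHS : 0 ≤ 2 / a * (|L (0, v)| + a / 2 * ‖v‖) * t := by
    have := ht.1.le
    positivity
  rcases le_or_gt D 0 with hD0 | hD0
  · exact hD0.trans hRHS
  · rw [abs_of_pos hD0] at h3
    have h4 : a / 2 * D ≤ (|L (0, v)| + a / 2 * ‖v‖) * t := by linarith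
    calc D = 2 / a * (a / 2 * D) := by field_simp
      _ ≤ 2 / a * ((|L (0, v)| + a / 2 * ‖v‖) * t) :=
        mul_le_mul_of_nonneg_left h4 (by positivity)
      _ = _ := by ring

theorem gradient_eq_zero_of_mem_graphMaximizers {z : E} (hz : z ∈ graphMaximizers ρ H G) :
    gradient (fun w => G (H z, w)) z + deriv (fun t => G (t, z)) (H z) • gradient H z = 0 := by
  have hzi := h.graphMaximizers_subset_interior hG hV hz
  have hpV : (H z, z) ∈ V := hV (subset_closure ⟨z, hz.1, rfl⟩)
  have h1 : HasFDerivAt (fun w => (H w, w))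
      ((fderiv ℝ H z).prod (ContinuousLinearMap.id ℝ E)) z :=
    (h.differentiableAt hzi).hasFDerivAt.prodMk (hasFDerivAt_id z)
  have h2 := HasFDerivAt.comp (f := fun w => (H w, w)) z (hG.hasFDerivAt hpV) h1
  have hloc : IsLocalMax (G ∘ fun w => (H w, w)) z := by
    filter_upwards [mem_interior_iff_mem_nhds.1 hzi] with w hw using hz.2 w hw
  have h3 := hloc.hasFDerivAt_eq_zero h2
  refine ext_inner_right ℝ fun v => ?_
  have h4 := congrArg (fun L => L v) h3
  have h5 : (fderiv ℝ H z v, v) = fderiv ℝ H z v • ((1 : ℝ), (0 : E)) + ((0 : ℝ), v) := by simp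
  simp only [ContinuousLinearMap.comp_apply, ContinuousLinearMap.prod_apply,
    ContinuousLinearMap.id_apply, _root_.zero_apply] at h4
  rw [h5, map_add, map_smul, hG.fderiv_inl hpV] at h4
  have h6 : inner ℝ (gradient (fun w => G (H z, w)) z) v = fderiv ℝ G (H z, z) (0, v) :=
    hG.inner_gradient hpV v
  rw [inner_add_left, real_inner_smul_left, h6, inner_gradient_left, inner_zero_left]
  simp only [smul_eq_mul] at h4
  linarith

end IsLegendreOn
end ConvexAnalysis

/-! ### Kolmogorov-Sinai entropy along mixtures of two measures. -/

section Entropy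

theorem negMulLog_add_le {x y : ℝ} (hx : 0 ≤ x) (hy : 0 ≤ y) :
    Real.negMulLog (x + y) ≤ Real.negMulLog x + Real.negMulLog y := by
  rcases hx.eq_or_lt with rfl | hx'
  · simp
  rcases hy.eq_or_lt with rfl | hy'
  · simp
  simp only [Real.negMulLog]
  have h1 := mul_le_mul_of_nonneg_left
    (Real.log_le_log hx' (le_add_of_nonneg_right hy : x ≤ x + y)) hx
  have h2 := mul_le_mul_of_nonneg_left
    (Real.log_le_log hy' (le_add_of_nonneg_left hx : y ≤ x + y)) hy
  linarith

variable {X : Type*} [MeasurableSpace X]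

section Partition

variable {ι : Type*} [Fintype ι] [MeasurableSpace ι] [MeasurableSingletonClass ι]

theorem sum_measureReal_fiber (μ : Measure X) [IsProbabilityMeasure μ] {f : X → ι}
    (hf : Measurable f) : ∑ i, μ.real (f ⁻¹' {i}) = 1 := by
  have := sum_measureReal_preimage_singleton (μ := μ) (f := f) Finset.univ
    (fun i _ => hf (measurableSet_singleton i))
  simpa using this

omit [MeasurableSpace ι] [MeasurableSingletonClass ι] in
theorem partitionEntropy_nonneg (μ : Measure X) [IsProbabilityMeasure μ] (f : X → ι) :
    0 ≤ partitionEntropy μ f :=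
  Finset.sum_nonneg fun _ _ => Real.negMulLog_nonneg measureReal_nonneg measureReal_le_one

variable {μ₀ μ₁ ν : Measure X} {a b : ℝ}

/-- Concavity of the Shannon entropy. -/
theorem le_partitionEntropy_of_mix (ha : 0 ≤ a) (hb : 0 ≤ b) (hab : a + b = 1)
    (hν : ∀ s, MeasurableSet s → ν.real s = a * μ₀.real s + b * μ₁.real s) {f : X → ι}
    (hf : Measurable f) :
    a * partitionEntropy μ₀ f + b * partitionEntropy μ₁ f ≤ partitionEntropy ν f := by
  simp only [partitionEntropy, Finset.mul_sum, ← Finset.sum_add_distrib]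
  refine Finset.sum_le_sum fun i _ => ?_
  rw [hν _ (hf (measurableSet_singleton i))]
  exact Real.concaveOn_negMulLog.2 (mem_Ici.2 measureReal_nonneg) (mem_Ici.2 measureReal_nonneg)
    ha hb hab

/-- Convexity of the Shannon entropy up to a constant. -/
theorem partitionEntropy_le_of_mix [IsProbabilityMeasure μ₀] [IsProbabilityMeasure μ₁]
    (ha : 0 ≤ a) (hb : 0 ≤ b)
    (hν : ∀ s, MeasurableSet s → ν.real s = a * μ₀.real s + b * μ₁.real s) {f : X → ι}
    (hf : Measurable f) :
    partitionEntropy ν f ≤ a * partitionEntropy μ₀ f + b * partitionEntropy μ₁ f +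
      (Real.negMulLog a + Real.negMulLog b) := by
  -- Subadditivity and the product formula for `negMulLog` split off the weights. Since fibre
  -- measures sum to one, the total defect does not depend on the partition.
  have key : ∀ i, Real.negMulLog (ν.real (f ⁻¹' {i})) ≤
      a * Real.negMulLog (μ₀.real (f ⁻¹' {i})) + b * Real.negMulLog (μ₁.real (f ⁻¹' {i})) +
      (μ₀.real (f ⁻¹' {i}) * Real.negMulLog a + μ₁.real (f ⁻¹' {i}) * Real.negMulLog b) := by
    intro i
    rw [hν _ (hf (measurableSet_singleton i))]
    refine (negMulLog_add_le (mul_nonneg ha measureReal_nonneg)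
      (mul_nonneg hb measureReal_nonneg)).trans (le_of_eq ?_)
    rw [Real.negMulLog_mul, Real.negMulLog_mul]
    ring
  refine (Finset.sum_le_sum fun i _ => key i).trans (le_of_eq ?_)
  rw [Finset.sum_add_distrib, Finset.sum_add_distrib, Finset.sum_add_distrib, ← Finset.mul_sum,
    ← Finset.mul_sum, ← Finset.sum_mul, ← Finset.sum_mul, sum_measureReal_fiber μ₀ hf,
    sum_measureReal_fiber μ₁ hf, one_mul, one_mul]
  rfl

end Partition

variable {T : X → X}

theorem measurable_itinerary (hT : Measurable T) {k : ℕ} {f : X → Fin k} (hf : Measurable f)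
    (n : ℕ) : Measurable (itinerary T f n) :=
  measurable_pi_lambda _ fun i => hf.comp (hT.iterate i)

theorem ksEntropy_nonneg (T : X → X) (μ : Measure X) [IsProbabilityMeasure μ] :
    0 ≤ ksEntropy T μ := by
  have h1 : 0 ≤ entropyOfPartition T μ (fun _ : X => (0 : Fin 1)) := by
    refine le_limsup_of_frequently_le' (Frequently.of_forall fun n => ?_)
    exact EReal.coe_nonneg.2 (div_nonneg (partitionEntropy_nonneg μ _) n.cast_nonneg)
  exact h1.trans (le_iSup_of_le 1 (le_iSup_of_le _ (le_iSup_of_le measurable_const le_rfl)))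

variable {μ₀ μ₁ ν : Measure X} {a b : ℝ}

/-- Lower bounds on upper limits do not add up over two measures, so the nonnegative term of `μ₁` is
dropped; what remains suffices for continuity at the endpoints. -/
theorem mul_le_ksEntropy_of_mix [IsProbabilityMeasure μ₁] (hT : Measurable T)
    (ha : 0 ≤ a) (hb : 0 ≤ b) (hab : a + b = 1)
    (hν : ∀ s, MeasurableSet s → ν.real s = a * μ₀.real s + b * μ₁.real s) {c : ℝ}
    (hc : (c : EReal) < ksEntropy T μ₀) : ((a * c : ℝ) : EReal) ≤ ksEntropy T ν := by
  simp only [ksEntropy, lt_iSup_iff] at hc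
  obtain ⟨k, f, hf, hlt⟩ := hc
  refine le_trans ?_ (le_iSup_of_le k (le_iSup_of_le f (le_iSup_of_le hf le_rfl)))
  refine le_limsup_of_frequently_le' ((frequently_lt_of_lt_limsup (by isBoundedDefault)
    hlt).mono fun n hn => ?_)
  have hn' := EReal.coe_lt_coe_iff.1 hn
  refine EReal.coe_le_coe_iff.2 ?_
  have h1 := le_partitionEntropy_of_mix ha hb hab hν (measurable_itinerary hT hf n)
  have h2 := mul_nonneg hb (partitionEntropy_nonneg μ₁ (itinerary T f n))
  calc a * c ≤ a * (partitionEntropy μ₀ (itinerary T f n) / n) :=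
        mul_le_mul_of_nonneg_left hn'.le ha
    _ = (a * partitionEntropy μ₀ (itinerary T f n)) / n := by ring
    _ ≤ _ := div_le_div_of_nonneg_right (by linarith) n.cast_nonneg

/-- The defect in `partitionEntropy_le_of_mix` is independent of `n` and vanishes after division by
`n`. -/
theorem ksEntropy_le_of_mix [IsProbabilityMeasure μ₀] [IsProbabilityMeasure μ₁]
    (hT : Measurable T) (ha : 0 ≤ a) (hb : 0 ≤ b) (hab : a + b = 1)
    (hν : ∀ s, MeasurableSet s → ν.real s = a * μ₀.real s + b * μ₁.real s) {c₀ c₁ : ℝ}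
    (h₀ : ksEntropy T μ₀ ≤ c₀) (h₁ : ksEntropy T μ₁ ≤ c₁) :
    ksEntropy T ν ≤ ((a * c₀ + b * c₁ : ℝ) : EReal) := by
  refine iSup_le fun k => iSup_le fun f => iSup_le fun hf => ?_
  refine EReal.le_of_forall_lt_iff_le.1 fun z hz => ?_
  have hz' := EReal.coe_lt_coe_iff.1 hz
  set ε := (z - (a * c₀ + b * c₁)) / 2 with hε
  have hεp : 0 < ε := by rw [hε]; linarith
  have bound : ∀ (μ : Measure X) (c : ℝ), ksEntropy T μ ≤ c →
      ∀ᶠ n : ℕ in atTop, partitionEntropy μ (itinerary T f n) / n < c + ε := by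
    intro μ c hμ
    have h1 : entropyOfPartition T μ f ≤ ksEntropy T μ :=
      le_iSup_of_le k (le_iSup_of_le f (le_iSup_of_le hf le_rfl))
    have h2 : entropyOfPartition T μ f < ((c + ε : ℝ) : EReal) :=
      (h1.trans hμ).trans_lt (EReal.coe_lt_coe_iff.2 (by linarith))
    filter_upwards [eventually_lt_of_limsup_lt h2] with n hn using EReal.coe_lt_coe_iff.1 hn
  have hlim : Tendsto (fun n : ℕ => (Real.negMulLog a + Real.negMulLog b) / (n : ℝ)) atTop
      (𝓝 0) := tendsto_const_div_atTop_nhds_zero_nat _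
  refine limsup_le_of_le (by isBoundedDefault) ?_
  filter_upwards [bound μ₀ c₀ h₀, bound μ₁ c₁ h₁, hlim.eventually_lt_const hεp]
    with n hn0 hn1 hn2
  refine EReal.coe_le_coe_iff.2 ?_
  have h1 := partitionEntropy_le_of_mix ha hb hν (measurable_itinerary hT hf n)
  have h2 := mul_le_mul_of_nonneg_left hn0.le ha
  have h3 := mul_le_mul_of_nonneg_left hn1.le hb
  have h4 : a * ε + b * ε = ε := by rw [← add_mul, hab, one_mul]
  calc partitionEntropy ν (itinerary T f n) / n
      ≤ (a * partitionEntropy μ₀ (itinerary T f n) + b * partitionEntropy μ₁ (itinerary T f n) +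
        (Real.negMulLog a + Real.negMulLog b)) / n :=
        div_le_div_of_nonneg_right h1 n.cast_nonneg
    _ = a * (partitionEntropy μ₀ (itinerary T f n) / n) +
        b * (partitionEntropy μ₁ (itinerary T f n) / n) +
        (Real.negMulLog a + Real.negMulLog b) / n := by ring
    _ ≤ z := by linarith

/-- The measure `(1 - t) μ₀ + t μ₁`. -/
noncomputable def mixMeasure (μ₀ μ₁ : Measure X) (t : ℝ) : Measure X :=
  ENNReal.ofReal (1 - t) • μ₀ + ENNReal.ofReal t • μ₁

theorem mixMeasure_real [IsFiniteMeasure μ₀] [IsFiniteMeasure μ₁] {t : ℝ} (ht : t ∈ Icc (0 : ℝ) 1)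
    (s : Set X) :
    (mixMeasure μ₀ μ₁ t).real s = (1 - t) * μ₀.real s + t * μ₁.real s := by
  have h1 : 0 ≤ 1 - t := sub_nonneg.2 ht.2
  simp only [mixMeasure, Measure.real, Measure.add_apply, Measure.smul_apply, smul_eq_mul]
  rw [ENNReal.toReal_add (ENNReal.mul_ne_top ENNReal.ofReal_ne_top (measure_ne_top _ _))
    (ENNReal.mul_ne_top ENNReal.ofReal_ne_top (measure_ne_top _ _)), ENNReal.toReal_mul,
    ENNReal.toReal_mul, ENNReal.toReal_ofReal h1, ENNReal.toReal_ofReal ht.1]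

theorem isProbabilityMeasure_mixMeasure [IsProbabilityMeasure μ₀] [IsProbabilityMeasure μ₁]
    {t : ℝ} (ht : t ∈ Icc (0 : ℝ) 1) : IsProbabilityMeasure (mixMeasure μ₀ μ₁ t) := by
  refine ⟨?_⟩
  simp only [mixMeasure, Measure.add_apply, Measure.smul_apply, smul_eq_mul, measure_univ, mul_one]
  rw [← ENNReal.ofReal_add (sub_nonneg.2 ht.2) ht.1, sub_add_cancel, ENNReal.ofReal_one]

theorem measurePreserving_mixMeasure (h₀ : MeasurePreserving T μ₀ μ₀)
    (h₁ : MeasurePreserving T μ₁ μ₁) (t : ℝ) :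
    MeasurePreserving T (mixMeasure μ₀ μ₁ t) (mixMeasure μ₀ μ₁ t) := by
  refine ⟨h₀.measurable, ?_⟩
  rw [mixMeasure, Measure.map_add _ _ h₀.measurable, Measure.map_smul, Measure.map_smul, h₀.map_eq,
    h₁.map_eq]

theorem integral_mixMeasure {t : ℝ} (ht : t ∈ Icc (0 : ℝ) 1) {ψ : X → ℝ} (h₀ : Integrable ψ μ₀)
    (h₁ : Integrable ψ μ₁) :
    ∫ x, ψ x ∂(mixMeasure μ₀ μ₁ t) = (1 - t) * ∫ x, ψ x ∂μ₀ + t * ∫ x, ψ x ∂μ₁ := by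
  rw [mixMeasure, integral_add_measure (h₀.smul_measure ENNReal.ofReal_ne_top)
    (h₁.smul_measure ENNReal.ofReal_ne_top), integral_smul_measure, integral_smul_measure,
    ENNReal.toReal_ofReal (sub_nonneg.2 ht.2), ENNReal.toReal_ofReal ht.1, smul_eq_mul, smul_eq_mul]

/-- The entropy takes all intermediate values along the segment between two measures. -/
theorem exists_ksEntropy_mixMeasure_eq [IsProbabilityMeasure μ₀] [IsProbabilityMeasure μ₁]
    (hT : Measurable T)
    (hfin : ∀ t ∈ Icc (0 : ℝ) 1, ksEntropy T (mixMeasure μ₀ μ₁ t) ≠ ⊤) {c : ℝ}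
    (hc : c ∈ Icc (ksEntropy T μ₀).toReal (ksEntropy T μ₁).toReal) :
    ∃ t ∈ Icc (0 : ℝ) 1, (ksEntropy T (mixMeasure μ₀ μ₁ t)).toReal = c := by
  set k : ℝ → ℝ := fun t => (ksEntropy T (mixMeasure μ₀ μ₁ t)).toReal with hk
  have h0 : mixMeasure μ₀ μ₁ 0 = μ₀ := by simp [mixMeasure]
  have h1 : mixMeasure μ₀ μ₁ 1 = μ₁ := by simp [mixMeasure]
  have hk0 : k 0 = (ksEntropy T μ₀).toReal := by simp only [hk, h0]
  have hk1 : k 1 = (ksEntropy T μ₁).toReal := by simp only [hk, h1]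
  have hcoe : ∀ t ∈ Icc (0 : ℝ) 1, ksEntropy T (mixMeasure μ₀ μ₁ t) = (k t : EReal) := by
    intro t ht
    have := isProbabilityMeasure_mixMeasure (μ₀ := μ₀) (μ₁ := μ₁) ht
    refine (EReal.coe_toReal (hfin t ht) ?_).symm
    exact ne_bot_of_le_ne_bot EReal.zero_ne_bot (ksEntropy_nonneg T _)
  have hk0' : ksEntropy T μ₀ = (k 0 : EReal) := by rw [← hcoe 0 (by simp), h0]
  have hk1' : ksEntropy T μ₁ = (k 1 : EReal) := by rw [← hcoe 1 (by simp), h1]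
  have hlow0 : ∀ t ∈ Icc (0 : ℝ) 1, (1 - t) * k 0 ≤ k t := by
    intro t ht
    refine le_of_forall_lt_imp_le_of_dense fun r hr => ?_
    rcases ht.2.eq_or_lt with rfl | ht1
    · have := isProbabilityMeasure_mixMeasure (μ₀ := μ₀) (μ₁ := μ₁) ht
      have : 0 ≤ k 1 := EReal.toReal_nonneg (ksEntropy_nonneg T _)
      simp only [sub_self, zero_mul] at hr
      linarith
    · have h1t : 0 < 1 - t := sub_pos.2 ht1
      have h2 := mul_le_ksEntropy_of_mix (c := r / (1 - t)) hT h1t.le ht.1 (by ring)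
        (fun s _ => mixMeasure_real (μ₀ := μ₀) (μ₁ := μ₁) ht s)
        (by rw [hk0', EReal.coe_lt_coe_iff, div_lt_iff₀ h1t]; linarith)
      rw [hcoe t ht, EReal.coe_le_coe_iff, mul_div_cancel₀ _ h1t.ne'] at h2
      exact h2
  have hlow1 : ∀ t ∈ Icc (0 : ℝ) 1, t * k 1 ≤ k t := by
    intro t ht
    refine le_of_forall_lt_imp_le_of_dense fun r hr => ?_
    rcases ht.1.eq_or_lt with rfl | ht1
    · have := isProbabilityMeasure_mixMeasure (μ₀ := μ₀) (μ₁ := μ₁) ht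
      have : 0 ≤ k 0 := EReal.toReal_nonneg (ksEntropy_nonneg T _)
      simp only [zero_mul] at hr
      linarith
    · have h2 := mul_le_ksEntropy_of_mix (c := r / t) hT ht.1 (sub_nonneg.2 ht.2)
        (by ring)
        (fun s _ => (mixMeasure_real (μ₀ := μ₀) (μ₁ := μ₁) ht s).trans (add_comm _ _))
        (by rw [hk1', EReal.coe_lt_coe_iff, div_lt_iff₀ ht1]; linarith)
      rw [hcoe t ht, EReal.coe_le_coe_iff, mul_div_cancel₀ _ ht1.ne'] at h2
      exact h2
  -- Convexity of `k` and the endpoint bounds `hlow0`, `hlow1` already give continuity; affinity of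
  -- the entropy is not needed.
  have hconc : ConcaveOn ℝ (Icc 0 1) (fun t => -k t) := by
    refine ⟨convex_Icc 0 1, fun s hs t ht a b ha hb hab => ?_⟩
    have hst : a • s + b • t ∈ Icc (0 : ℝ) 1 := convex_Icc 0 1 hs ht ha hb hab
    have := isProbabilityMeasure_mixMeasure (μ₀ := μ₀) (μ₁ := μ₁) hs
    have := isProbabilityMeasure_mixMeasure (μ₀ := μ₀) (μ₁ := μ₁) ht
    have h2 := ksEntropy_le_of_mix (μ₀ := mixMeasure μ₀ μ₁ s) (μ₁ := mixMeasure μ₀ μ₁ t)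
      (ν := mixMeasure μ₀ μ₁ (a • s + b • t)) hT ha hb hab (fun u _ => by
        rw [mixMeasure_real hst, mixMeasure_real hs, mixMeasure_real ht]
        obtain rfl : a = 1 - b := by linarith
        simp only [smul_eq_mul]
        ring) (hcoe s hs).le (hcoe t ht).le
    rw [hcoe _ hst, EReal.coe_le_coe_iff] at h2
    simp only [smul_eq_mul] at h2 ⊢
    linarith
  have hcont : ContinuousOn (fun t => -k t) (Icc 0 1) := by
    refine hconc.continuousOn_Icc_of_upperSemicontinuousWithinAt ?_ ?_
    · intro r hr
      have : Continuous fun t : ℝ => -((1 - t) * k 0) := by fun_prop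
      have h2 := (this.tendsto 0).eventually_lt_const (u := r) (by simpa using hr)
      filter_upwards [mem_nhdsWithin_of_mem_nhds h2, self_mem_nhdsWithin] with t ht1 ht2
      linarith [hlow0 t ht2]
    · intro r hr
      have : Continuous fun t : ℝ => -(t * k 1) := by fun_prop
      have h2 := (this.tendsto 1).eventually_lt_const (u := r) (by simpa using hr)
      filter_upwards [mem_nhdsWithin_of_mem_nhds h2, self_mem_nhdsWithin] with t ht1 ht2
      linarith [hlow1 t ht2]
  have hcont' : ContinuousOn k (Icc 0 1) := hcont.neg.congr fun t _ => (neg_neg _).symm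
  rw [← hk0, ← hk1] at hc
  obtain ⟨t, ht, rfl⟩ := intermediate_value_Icc zero_le_one hcont' hc
  exact ⟨t, ht, rfl⟩

end Entropy

/-! ### Transfer between invariant measures and the entropy function on the rotation set. -/

section LegendreSystem

variable {X : Type*} [MetricSpace X] [CompactSpace X] [MeasurableSpace X] [BorelSpace X]
  {d : ℕ} {T : X → X} {φ : Fin d → C(X, ℝ)}

theorem continuous_meanVector : Continuous (meanVector (X := X) φ) :=
  (PiLp.continuous_toLp 2 _).comp
    (continuous_pi fun i => ProbabilityMeasure.continuous_integral_continuousMap (φ i))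

theorem isCompact_invariantMeasures (hT : Continuous T) : IsCompact (invariantMeasures T) := by
  have h1 : invariantMeasures T =
      {μ : ProbabilityMeasure X | μ.map hT.measurable.aemeasurable = μ} := by
    ext μ
    refine ⟨fun h => Subtype.ext h.map_eq, fun h => ⟨hT.measurable, ?_⟩⟩
    exact congrArg (fun ν : ProbabilityMeasure X => (ν : Measure X)) h
  rw [h1]
  exact (isClosed_eq (ProbabilityMeasure.continuous_map hT) continuous_id).isCompact

theorem isCompact_rotationSet (hT : Continuous T) : IsCompact (rotationSet T φ) :=
  (isCompact_invariantMeasures hT).image continuous_meanVector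

omit [CompactSpace X] [BorelSpace X] in
theorem ksEntropy_le_entropyFn {μ : ProbabilityMeasure X} (hμ : μ ∈ invariantMeasures T) :
    ksEntropy T (μ : Measure X) ≤ entropyFn T φ (meanVector φ μ) :=
  le_iSup₂ (f := fun (ν : ProbabilityMeasure X)
    (_ : ν ∈ {ν : ProbabilityMeasure X | ν ∈ invariantMeasures T ∧
      meanVector φ ν = meanVector φ μ}) => ksEntropy T (ν : Measure X)) μ ⟨hμ, rfl⟩

omit [CompactSpace X] [BorelSpace X] in
theorem exists_lt_ksEntropy {z : EuclideanSpace ℝ (Fin d)} {c : EReal}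
    (hc : c < entropyFn T φ z) :
    ∃ μ ∈ invariantMeasures T, meanVector φ μ = z ∧ c < ksEntropy T (μ : Measure X) := by
  simp only [entropyFn, lt_iSup_iff] at hc
  obtain ⟨μ, hμ, h⟩ := hc
  exact ⟨μ, hμ.1, hμ.2, h⟩

omit [CompactSpace X] [BorelSpace X] in
theorem entropyFn_nonneg {z : EuclideanSpace ℝ (Fin d)} (hz : z ∈ rotationSet T φ) :
    0 ≤ entropyFn T φ z := by
  obtain ⟨μ, hμ, rfl⟩ := hz
  exact (ksEntropy_nonneg T _).trans (ksEntropy_le_entropyFn hμ)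

omit [CompactSpace X] [BorelSpace X] in
theorem entropyFn_eq_bot {z : EuclideanSpace ℝ (Fin d)} (hz : z ∉ rotationSet T φ) :
    entropyFn T φ z = ⊥ := by
  by_contra h
  obtain ⟨μ, hμ, rfl, -⟩ := exists_lt_ksEntropy (bot_lt_iff_ne_bot.2 h)
  exact hz ⟨μ, hμ, rfl⟩

theorem inner_meanVector (y : EuclideanSpace ℝ (Fin d)) (μ : ProbabilityMeasure X) :
    inner ℝ y (meanVector φ μ) = ∫ x, dotPotential φ y x ∂(μ : Measure X) := by
  have hint : ∀ i, Integrable (fun x => φ i x) (μ : Measure X) := fun i =>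
    (φ i).continuous.integrable_of_hasCompactSupport (HasCompactSupport.of_compactSpace _)
  simp only [dotPotential, PiLp.inner_apply, meanVector]
  rw [integral_finsetSum _ fun i _ => (hint i).const_mul (y i)]
  refine Finset.sum_congr rfl fun i _ => ?_
  rw [integral_const_mul]
  simp [mul_comm]

namespace IsLegendreSystem

variable {r : WithTop ℕ∞} (hT : IsLegendreSystem r T φ)
include hT

omit [CompactSpace X] [BorelSpace X] in
theorem effectiveDomain_eq : effectiveDomain (entropyFn T φ) = rotationSet T φ := by
  ext z
  constructor
  · intro hz
    by_contra h
    exact hz.1 (entropyFn_eq_bot h)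
  · intro hz
    exact ⟨ne_bot_of_le_ne_bot EReal.zero_ne_bot (entropyFn_nonneg hz), hT.legendre.ne_top z⟩

omit [CompactSpace X] [BorelSpace X] in
theorem coe_entropyFnReal {z : EuclideanSpace ℝ (Fin d)} (hz : z ∈ rotationSet T φ) :
    (entropyFnReal T φ z : EReal) = entropyFn T φ z := by
  rw [← hT.effectiveDomain_eq] at hz
  exact EReal.coe_toReal hz.2 hz.1

-- Finiteness comes from `h(T, μ) ≤ 𝗁(μ(φ))` and the exclusion of `+∞` in the Legendre type.
omit [CompactSpace X] [BorelSpace X] in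
theorem coe_ksEntropy {μ : ProbabilityMeasure X} (hμ : μ ∈ invariantMeasures T) :
    ((ksEntropy T (μ : Measure X)).toReal : EReal) = ksEntropy T (μ : Measure X) :=
  EReal.coe_toReal
    (ne_top_of_le_ne_top (hT.legendre.ne_top _) (ksEntropy_le_entropyFn (φ := φ) hμ))
    (ne_bot_of_le_ne_bot EReal.zero_ne_bot (ksEntropy_nonneg T _))

omit [CompactSpace X] [BorelSpace X] in
theorem toReal_ksEntropy_le {μ : ProbabilityMeasure X} (hμ : μ ∈ invariantMeasures T) :
    (ksEntropy T (μ : Measure X)).toReal ≤ entropyFnReal T φ (meanVector φ μ) := by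
  rw [← EReal.coe_le_coe_iff, hT.coe_ksEntropy hμ, hT.coe_entropyFnReal ⟨μ, hμ, rfl⟩]
  exact ksEntropy_le_entropyFn hμ

omit [CompactSpace X] [BorelSpace X] in
theorem exists_lt_toReal_ksEntropy {z : EuclideanSpace ℝ (Fin d)} (hz : z ∈ rotationSet T φ)
    {c : ℝ} (hc : c < entropyFnReal T φ z) :
    ∃ μ ∈ invariantMeasures T, meanVector φ μ = z ∧ c < (ksEntropy T (μ : Measure X)).toReal := by
  rw [← EReal.coe_lt_coe_iff, hT.coe_entropyFnReal hz] at hc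
  obtain ⟨μ, hμ, hm, h⟩ := exists_lt_ksEntropy hc
  rw [← hT.coe_ksEntropy hμ, EReal.coe_lt_coe_iff] at h
  exact ⟨μ, hμ, hm, h⟩

/-- The entropy function of a Legendre system is of Legendre type on the rotation set. -/
theorem isLegendreOn (hr : 1 ≤ r) : IsLegendreOn (rotationSet T φ) (entropyFnReal T φ) := by
  have hL := hT.legendre
  have hdom := hT.effectiveDomain_eq
  refine ⟨isCompact_rotationSet hT.continuous, ?_, hdom ▸ hL.concave, ?_, hT.interior_nonempty,
    hdom ▸ hL.strictConcave, (hdom ▸ hL.contDiff).of_le hr, hdom ▸ hL.gradient_blowup⟩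
  · intro z hz c hc
    have h1 : entropyFn T φ z < (c : EReal) := by
      rw [← hT.coe_entropyFnReal hz]; exact EReal.coe_lt_coe_iff.2 hc
    filter_upwards [mem_nhdsWithin_of_mem_nhds (hL.upperSemicontinuous z _ h1),
      self_mem_nhdsWithin] with w hw hwρ
    rw [← EReal.coe_lt_coe_iff, hT.coe_entropyFnReal hwρ]
    exact hw
  · intro z hz
    exact EReal.toReal_nonneg (entropyFn_nonneg hz)

theorem pressureOfMeasure_eq (y : EuclideanSpace ℝ (Fin d)) {μ : ProbabilityMeasure X}
    (hμ : μ ∈ invariantMeasures T) :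
    pressureOfMeasure T (dotPotential φ y) μ =
      (((ksEntropy T (μ : Measure X)).toReal + inner ℝ y (meanVector φ μ) : ℝ) : EReal) := by
  rw [pressureOfMeasure, ← inner_meanVector, EReal.coe_add, hT.coe_ksEntropy hμ]

/-- The pressure function is the conjugate of the entropy function. -/
theorem pressureFn_eq (hr : 1 ≤ r) (y : EuclideanSpace ℝ (Fin d)) :
    pressureFn T φ y = (tiltSup (rotationSet T φ) (entropyFnReal T φ) y : EReal) := by
  have hL := hT.isLegendreOn hr
  refine le_antisymm (iSup₂_le fun μ hμ => ?_) (EReal.ge_of_forall_gt_iff_ge.1 fun c hc => ?_)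
  · rw [hT.pressureOfMeasure_eq y hμ, EReal.coe_le_coe_iff]
    have h1 := hL.tilt_le_tiltSup y (w := meanVector φ μ) ⟨μ, hμ, rfl⟩
    have h2 := hT.toReal_ksEntropy_le hμ
    simp only [tilt] at h1
    linarith
  -- The supremum defining `𝗁` at the maximizer may not be attained, so it is approached by measures
  -- in the fibre.
  · rw [EReal.coe_lt_coe_iff, hL.tiltSup_eq, tilt] at hc
    obtain ⟨μ, hμ, hm, h⟩ := hT.exists_lt_toReal_ksEntropy (hL.argmax_mem y)
      (sub_lt_iff_lt_add.2 hc)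
    refine le_trans ?_ (le_iSup₂ (f := fun (ν : ProbabilityMeasure X)
      (_ : ν ∈ invariantMeasures T) => pressureOfMeasure T (dotPotential φ y) ν) μ hμ)
    rw [hT.pressureOfMeasure_eq y hμ, EReal.coe_le_coe_iff, hm]
    linarith

theorem pressureFnReal_eq (hr : 1 ≤ r) :
    pressureFnReal T φ = tiltSup (rotationSet T φ) (entropyFnReal T φ) := by
  funext y
  rw [pressureFnReal, hT.pressureFn_eq hr, EReal.toReal_coe]

theorem neg_entropyFn_eq (hr : 1 ≤ r) (z : EuclideanSpace ℝ (Fin d)) :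
    -entropyFn T φ z = ⨆ y, (((inner ℝ y z : ℝ) : EReal) - pressureFn T φ y) := by
  have hL := hT.isLegendreOn hr
  simp only [hT.pressureFn_eq hr, ← EReal.coe_sub]
  refine le_antisymm (EReal.ge_of_forall_gt_iff_ge.1 fun c hc => ?_) (iSup_le fun y => ?_)
  · obtain ⟨y, hy⟩ : ∃ y, tiltSup (rotationSet T φ) (entropyFnReal T φ) y ≤
        inner ℝ y z + -c := by
      by_cases hz : z ∈ rotationSet T φ
      · refine hL.exists_tiltSup_le hz ?_
        rw [← hT.coe_entropyFnReal hz, ← EReal.coe_neg, EReal.coe_lt_coe_iff] at hc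
        linarith
      · exact hL.exists_tiltSup_le_of_notMem hz _
    refine le_trans ?_ (le_iSup _ y)
    rw [EReal.coe_le_coe_iff]
    linarith
  · by_cases hz : z ∈ rotationSet T φ
    · rw [← hT.coe_entropyFnReal hz, ← EReal.coe_neg, EReal.coe_le_coe_iff]
      have := hL.tilt_le_tiltSup y hz
      simp only [tilt] at this
      linarith
    · rw [entropyFn_eq_bot hz, EReal.neg_bot]
      exact le_top

/-- The pressure bound chains `h(T, μ) ≤ 𝗁(μ(φ))` with `tilt ≤ tiltSup`. Equality overall means
equality in both, and the second holds only at the unique maximizer `∇𝖯(y)`. -/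
theorem mem_linearEquilibriumMeasures_iff (hr : 1 ≤ r) {y : EuclideanSpace ℝ (Fin d)}
    {μ : ProbabilityMeasure X} :
    μ ∈ linearEquilibriumMeasures T (dotPotential φ y) ↔ μ ∈ invariantMeasures T ∧
      meanVector φ μ = gradient (pressureFnReal T φ) y ∧
      (ksEntropy T (μ : Measure X)).toReal = entropyFnReal T φ (meanVector φ μ) := by
  have hL := hT.isLegendreOn hr
  rw [hT.pressureFnReal_eq hr, hL.gradient_tiltSup]
  refine and_congr_right fun hμ => ?_
  have hP : linearPressure T (dotPotential φ y) = _ := hT.pressureFn_eq hr y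
  have hmem : meanVector φ μ ∈ rotationSet T φ := ⟨μ, hμ, rfl⟩
  rw [hP, hT.pressureOfMeasure_eq y hμ, EReal.coe_eq_coe_iff, ← hL.tilt_eq_tiltSup_iff hmem]
  have h1 := hL.tilt_le_tiltSup y hmem
  have h2 := hT.toReal_ksEntropy_le hμ
  simp only [tilt] at h1 ⊢
  constructor
  · intro h
    constructor <;> linarith
  · rintro ⟨h3, h4⟩
    linarith

/-- The values of the entropy over a fibre of the mean vector form an interval. -/
theorem exists_toReal_ksEntropy_eq {μ : ProbabilityMeasure X} (hμ : μ ∈ invariantMeasures T)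
    {c : ℝ} (hc : c ∈ Ico (ksEntropy T (μ : Measure X)).toReal
      (entropyFnReal T φ (meanVector φ μ))) :
    ∃ ν ∈ invariantMeasures T, meanVector φ ν = meanVector φ μ ∧
      (ksEntropy T (ν : Measure X)).toReal = c := by
  -- As `c` is strictly below the supremum, some `μ₁` in the same fibre exceeds it, attained or not;
  -- mixtures of `μ` and `μ₁` stay in the fibre.
  obtain ⟨μ₁, hμ₁, hm, h⟩ := hT.exists_lt_toReal_ksEntropy ⟨μ, hμ, rfl⟩ hc.2
  have hprob : ∀ t ∈ Icc (0 : ℝ) 1,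
      IsProbabilityMeasure (mixMeasure (μ : Measure X) (μ₁ : Measure X) t) := fun t ht =>
    isProbabilityMeasure_mixMeasure ht
  have hinv : ∀ t (ht : t ∈ Icc (0 : ℝ) 1),
      (⟨mixMeasure (μ : Measure X) (μ₁ : Measure X) t, hprob t ht⟩ : ProbabilityMeasure X) ∈
        invariantMeasures T := fun t _ => measurePreserving_mixMeasure hμ hμ₁ t
  obtain ⟨t, ht, hk⟩ := exists_ksEntropy_mixMeasure_eq (μ₀ := (μ : Measure X))
    (μ₁ := (μ₁ : Measure X)) hT.continuous.measurable
    (fun t ht => by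
      have := hT.coe_ksEntropy (hinv t ht)
      exact fun htop => EReal.coe_ne_top _ (this.trans htop)) ⟨hc.1, h.le⟩
  refine ⟨_, hinv t ht, ?_, hk⟩
  ext i
  have hint : ∀ μ : ProbabilityMeasure X, Integrable (φ i) (μ : Measure X) := fun μ =>
    (φ i).continuous.integrable_of_hasCompactSupport (HasCompactSupport.of_compactSpace _)
  have hmi : ∫ x, φ i x ∂(μ₁ : Measure X) = ∫ x, φ i x ∂(μ : Measure X) :=
    congrArg (fun v : EuclideanSpace ℝ (Fin d) => v i) hm
  change ∫ x, φ i x ∂(mixMeasure (μ : Measure X) (μ₁ : Measure X) t) =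
    ∫ x, φ i x ∂(μ : Measure X)
  rw [integral_mixMeasure ht (hint μ) (hint μ₁), hmi]
  ring

variable {V : Set (ℝ × EuclideanSpace ℝ (Fin d))} {G : ℝ × EuclideanSpace ℝ (Fin d) → ℝ}

/-- Along the fibre of the mean vector, `G` increases with the entropy. -/
theorem strictMonoOn_fibre (hG : IsMonotoneEnergy V G)
    (hVm : entropyMean T φ '' invariantMeasures T ⊆ V)
    (hVg : closure (graphPoint T φ '' rotationSet T φ) ⊆ V) {μ : ProbabilityMeasure X}
    (hμ : μ ∈ invariantMeasures T) :
    StrictMonoOn (fun a => G (a, meanVector φ μ))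
      (Icc (ksEntropy T (μ : Measure X)).toReal (entropyFnReal T φ (meanVector φ μ))) := by
  refine hG.strictMonoOn fun a ha => ?_
  -- The top endpoint may not be realized by a measure and lies in `V` as a graph point; every lower
  -- point is realized.
  rcases ha.2.eq_or_lt with rfl | hlt
  · exact hVg (subset_closure ⟨_, ⟨μ, hμ, rfl⟩, rfl⟩)
  · obtain ⟨ν, hν, hm, hk⟩ := hT.exists_toReal_ksEntropy_eq hμ ⟨ha.1, hlt⟩
    refine hVm ⟨ν, hν, ?_⟩
    rw [entropyMean, hm, hk]

/-- The nonlinear equilibrium measures are those which achieve the supremum defining the entropy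
function at a maximizer. -/
theorem mem_nonlinearEquilibriumMeasures_iff (hr : 1 ≤ r) (hG : IsMonotoneEnergy V G)
    (hVm : entropyMean T φ '' invariantMeasures T ⊆ V)
    (hVg : closure (graphPoint T φ '' rotationSet T φ) ⊆ V) {μ : ProbabilityMeasure X} :
    μ ∈ nonlinearEquilibriumMeasures T φ G ↔ μ ∈ invariantMeasures T ∧
      meanVector φ μ ∈ maximizers T φ G ∧
      (ksEntropy T (μ : Measure X)).toReal = entropyFnReal T φ (meanVector φ μ) := by
  have hL := hT.isLegendreOn hr
  have hle : ∀ ν ∈ invariantMeasures T,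
      G (entropyMean T φ ν) ≤ G (graphPoint T φ (meanVector φ ν)) := fun ν hν => by
    have h := hT.toReal_ksEntropy_le (φ := φ) hν
    exact (hT.strictMonoOn_fibre hG hVm hVg hν).monotoneOn (left_mem_Icc.2 h)
      (right_mem_Icc.2 h) h
  constructor
  · rintro ⟨hμ, hmax⟩
    -- Continuity of `G` at the graph point lets measures with nearly maximal entropy over `w`
    -- replace a possibly missing optimal one.
    have hge : ∀ w ∈ rotationSet T φ, G (graphPoint T φ w) ≤ G (entropyMean T φ μ) := by
      intro w hw
      refine le_of_forall_lt fun c hc => ?_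
      have hpV : graphPoint T φ w ∈ V := hVg (subset_closure ⟨w, hw, rfl⟩)
      have hcont : ContinuousAt (fun a : ℝ => G (a, w)) (entropyFnReal T φ w) :=
        ContinuousAt.comp (f := fun a : ℝ => (a, w)) (g := G) (x := entropyFnReal T φ w)
          (hG.contDiffOn.continuousOn.continuousAt (hG.isOpen.mem_nhds hpV)) (by fun_prop)
      have hev := hcont.eventually_const_lt hc
      obtain ⟨ε, hε, hball⟩ := Metric.eventually_nhds_iff.1 hev
      obtain ⟨ν, hν, hm, hk⟩ := hT.exists_lt_toReal_ksEntropy hw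
        (sub_lt_self (entropyFnReal T φ w) hε)
      have hk' := hT.toReal_ksEntropy_le (φ := φ) hν
      rw [hm] at hk'
      have h1 := hball (y := (ksEntropy T (ν : Measure X)).toReal) (by
        rw [Real.dist_eq, abs_lt]; constructor <;> linarith)
      refine lt_of_lt_of_le h1 ?_
      have h2 := hmax ν hν
      rwa [entropyMean, hm] at h2
    have hmem : meanVector φ μ ∈ rotationSet T φ := ⟨μ, hμ, rfl⟩
    refine ⟨hμ, ⟨hmem, fun w hw => (hge w hw).trans (hle μ hμ)⟩, ?_⟩
    have h := hT.toReal_ksEntropy_le (φ := φ) hμ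
    refine h.antisymm (le_of_not_gt fun hlt => ?_)
    exact absurd (hge _ hmem) (not_le.2 ((hT.strictMonoOn_fibre hG hVm hVg hμ)
      (left_mem_Icc.2 h) (right_mem_Icc.2 h) hlt))
  · rintro ⟨hμ, hmax, hk⟩
    refine ⟨hμ, fun ν hν => (hle ν hν).trans ?_⟩
    have : entropyMean T φ μ = graphPoint T φ (meanVector φ μ) := by
      rw [entropyMean, hk, graphPoint]
    rw [this]
    exact hmax.2 _ ⟨ν, hν, rfl⟩

omit [CompactSpace X] in
theorem upperSemicontinuousOn_toReal_ksEntropy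
    (hu : UpperSemicontinuousOn (fun μ : ProbabilityMeasure X => ksEntropy T (μ : Measure X))
      (invariantMeasures T)) :
    UpperSemicontinuousOn (fun μ : ProbabilityMeasure X => (ksEntropy T (μ : Measure X)).toReal)
      (invariantMeasures T) := by
  intro μ hμ c hc
  have h1 : ksEntropy T (μ : Measure X) < (c : EReal) := by
    rw [← hT.coe_ksEntropy hμ]; exact EReal.coe_lt_coe_iff.2 hc
  filter_upwards [hu μ hμ _ h1, self_mem_nhdsWithin] with ν hν hνi
  rw [← EReal.coe_lt_coe_iff, hT.coe_ksEntropy hνi]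
  exact hν

/-- Upper semicontinuity of the entropy gives linear equilibrium measures. -/
theorem linearEquilibriumMeasures_nonempty
    (hu : UpperSemicontinuousOn (fun μ : ProbabilityMeasure X => ksEntropy T (μ : Measure X))
      (invariantMeasures T)) (y : EuclideanSpace ℝ (Fin d)) :
    (linearEquilibriumMeasures T (dotPotential φ y)).Nonempty := by
  have hcont : Continuous fun μ : ProbabilityMeasure X => (inner ℝ y (meanVector φ μ) : ℝ) :=
    continuous_const.inner continuous_meanVector
  have hne : (invariantMeasures T).Nonempty :=
    (hT.interior_nonempty.mono interior_subset).of_image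
  obtain ⟨μ, hμ, hmax⟩ := ((hT.upperSemicontinuousOn_toReal_ksEntropy hu).add
    (hcont.upperSemicontinuous.upperSemicontinuousOn _)).exists_isMaxOn hne
    (isCompact_invariantMeasures hT.continuous)
  refine ⟨μ, hμ, le_antisymm (le_iSup₂ (f := fun (ν : ProbabilityMeasure X)
      (_ : ν ∈ invariantMeasures T) => pressureOfMeasure T (dotPotential φ y) ν) μ hμ)
    (iSup₂_le fun ν hν => ?_)⟩
  rw [hT.pressureOfMeasure_eq y hμ, hT.pressureOfMeasure_eq y hν, EReal.coe_le_coe_iff]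
  exact hmax hν

theorem isCompact_nonlinearEquilibriumMeasures (hr : 1 ≤ r) (hG : IsMonotoneEnergy V G)
    (hVm : entropyMean T φ '' invariantMeasures T ⊆ V)
    (hVg : closure (graphPoint T φ '' rotationSet T φ) ⊆ V)
    (hu : UpperSemicontinuousOn (fun μ : ProbabilityMeasure X => ksEntropy T (μ : Measure X))
      (invariantMeasures T)) : IsCompact (nonlinearEquilibriumMeasures T φ G) := by
  have hL := hT.isLegendreOn hr
  have hmaxc : IsCompact (maximizers T φ G) := hL.isCompact_graphMaximizers hG hVg
  have hmaxi : maximizers T φ G ⊆ interior (rotationSet T φ) :=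
    hL.graphMaximizers_subset_interior hG hVg
  have hK : IsCompact (invariantMeasures T ∩ meanVector φ ⁻¹' maximizers T φ G) :=
    (isCompact_invariantMeasures hT.continuous).inter_right
      (hmaxc.isClosed.preimage continuous_meanVector)
  -- Maximizers are interior, where `𝗁` is continuous. So `h(T, μ) - 𝗁(μ(φ))` is upper
  -- semicontinuous here, and since it is never positive its zero set is a superlevel set.
  have hHc : ContinuousOn (fun μ : ProbabilityMeasure X => -entropyFnReal T φ (meanVector φ μ))
      (invariantMeasures T ∩ meanVector φ ⁻¹' maximizers T φ G) := fun μ hμ =>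
    ((hL.continuousAt (hmaxi hμ.2)).comp
      continuous_meanVector.continuousAt).neg.continuousWithinAt
  have husc := ((hT.upperSemicontinuousOn_toReal_ksEntropy hu).mono
    (inter_subset_left (t := meanVector φ ⁻¹' maximizers T φ G))).add
      hHc.upperSemicontinuousOn
  convert husc.isCompact_inter_preimage_Ici hK 0 using 1
  ext μ
  rw [hT.mem_nonlinearEquilibriumMeasures_iff hr hG hVm hVg]
  constructor
  · rintro ⟨hμ, hm, hk⟩
    exact ⟨⟨hμ, hm⟩, by simp [hk]⟩
  · rintro ⟨⟨hμ, hm⟩, hk⟩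
    refine ⟨hμ, hm, (hT.toReal_ksEntropy_le hμ).antisymm ?_⟩
    simp only [mem_preimage, mem_Ici] at hk
    linarith

theorem slopes_eq (hr : 1 ≤ r) (hG : IsMonotoneEnergy V G)
    (hVg : closure (graphPoint T φ '' rotationSet T φ) ⊆ V) :
    slopes T φ G = gradient (pressureFnReal T φ) ⁻¹' maximizers T φ G := by
  rw [hT.pressureFnReal_eq hr]
  exact (hT.isLegendreOn hr).image_neg_gradient_eq_preimage
    ((hT.isLegendreOn hr).graphMaximizers_subset_interior hG hVg)

theorem isCompact_slopes (hr : 1 ≤ r) (hG : IsMonotoneEnergy V G)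
    (hVg : closure (graphPoint T φ '' rotationSet T φ) ⊆ V) : IsCompact (slopes T φ G) :=
  have hL := hT.isLegendreOn hr
  (hL.isCompact_graphMaximizers hG hVg).image_of_continuousOn
    (hL.continuousOn_gradient.neg.mono (hL.graphMaximizers_subset_interior hG hVg))

theorem nonlinearEquilibriumMeasures_eq (hr : 1 ≤ r) (hG : IsMonotoneEnergy V G)
    (hVm : entropyMean T φ '' invariantMeasures T ⊆ V)
    (hVg : closure (graphPoint T φ '' rotationSet T φ) ⊆ V) :
    nonlinearEquilibriumMeasures T φ G =
      ⋃ y ∈ slopes T φ G, linearEquilibriumMeasures T (dotPotential φ y) := by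
  ext μ
  simp only [mem_iUnion, exists_prop, hT.mem_nonlinearEquilibriumMeasures_iff hr hG hVm hVg,
    hT.mem_linearEquilibriumMeasures_iff hr]
  constructor
  · rintro ⟨hμ, hm, hk⟩
    have h : -gradient (entropyFnReal T φ) (meanVector φ μ) ∈ slopes T φ G := ⟨_, hm, rfl⟩
    refine ⟨_, h, hμ, ?_, hk⟩
    have hL := hT.isLegendreOn hr
    rw [hT.pressureFnReal_eq hr, hL.gradient_tiltSup, hL.argmax_neg_gradient
      (hL.graphMaximizers_subset_interior hG hVg hm)]
  · rintro ⟨y, hy, hμ, hm, hk⟩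
    rw [hT.slopes_eq hr hG hVg] at hy
    exact ⟨hμ, hm ▸ hy, hk⟩

/-- Any linear equilibrium measure for the slope `-∇𝗁(z)` has mean `∇𝖯(-∇𝗁(z)) = z`, so every
maximizer is reached. -/
theorem image_meanVector_eq (hr : 1 ≤ r) (hG : IsMonotoneEnergy V G)
    (hVm : entropyMean T φ '' invariantMeasures T ⊆ V)
    (hVg : closure (graphPoint T φ '' rotationSet T φ) ⊆ V)
    (hne : ∀ y ∈ slopes T φ G, (linearEquilibriumMeasures T (dotPotential φ y)).Nonempty) :
    (nonlinearEquilibriumMeasures T φ G).Nonempty ∧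
      meanVector φ '' nonlinearEquilibriumMeasures T φ G = maximizers T φ G := by
  have hL := hT.isLegendreOn hr
  have himg : meanVector φ '' nonlinearEquilibriumMeasures T φ G = maximizers T φ G := by
    ext z
    constructor
    · rintro ⟨μ, hμ, rfl⟩
      exact ((hT.mem_nonlinearEquilibriumMeasures_iff hr hG hVm hVg).1 hμ).2.1
    · intro hz
      have hy : -gradient (entropyFnReal T φ) z ∈ slopes T φ G := ⟨z, hz, rfl⟩
      obtain ⟨μ, hμ⟩ := hne _ hy
      refine ⟨μ, ?_, ?_⟩
      · rw [hT.nonlinearEquilibriumMeasures_eq hr hG hVm hVg]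
        exact mem_biUnion hy hμ
      · rw [((hT.mem_linearEquilibriumMeasures_iff hr).1 hμ).2.1, hT.pressureFnReal_eq hr,
          hL.gradient_tiltSup, hL.argmax_neg_gradient
          (hL.graphMaximizers_subset_interior hG hVg hz)]
  refine ⟨?_, himg⟩
  have : (maximizers T φ G).Nonempty := hL.graphMaximizers_nonempty hG hVg
  rw [← himg] at this
  exact this.of_image

end IsLegendreSystem

end LegendreSystem

/-! ### The energy case and the final assembly. -/

/-- The function `z₀ + F z` is monotone on `ℝ × U`. -/
theorem isMonotoneEnergy_ofEnergy {d : ℕ} {U : Set (EuclideanSpace ℝ (Fin d))}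
    {F : EuclideanSpace ℝ (Fin d) → ℝ} (hU : IsOpen U) (hF : ContDiffOn ℝ 1 F U) :
    IsMonotoneEnergy (univ ×ˢ U) (ofEnergy F) := by
  refine ⟨isOpen_univ.prod hU, ?_, fun p _ => ?_⟩
  · exact contDiff_fst.contDiffOn.add (hF.comp contDiff_snd.contDiffOn fun p hp => hp.2)
  · simp [ofEnergy]

theorem spatialGradient_ofEnergy {d : ℕ} (F : EuclideanSpace ℝ (Fin d) → ℝ)
    (p : ℝ × EuclideanSpace ℝ (Fin d)) :
    spatialGradient (ofEnergy F) p = gradient F p.2 := by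
  simp only [spatialGradient, ofEnergy, gradient]
  rw [fderiv_const_add]

theorem partialZero_ofEnergy {d : ℕ} (F : EuclideanSpace ℝ (Fin d) → ℝ)
    (p : ℝ × EuclideanSpace ℝ (Fin d)) : partialZero (ofEnergy F) p = 1 := by
  simp [partialZero, ofEnergy]

end NonlinearFormalism

theorem theoremC {X : Type*} [MetricSpace X] [CompactSpace X] [MeasurableSpace X] [BorelSpace X]
    {d : ℕ} (hd : 0 < d) (r : WithTop ℕ∞) (hr : 1 ≤ r)
    (T : X → X) (φ : Fin d → C(X, ℝ)) (hT : IsLegendreSystem r T φ) :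
    -- the pressure function is finite and differentiable, and `-𝗁` is its Legendre dual
    ((∀ y, pressureFn T φ y ≠ ⊥ ∧ pressureFn T φ y ≠ ⊤) ∧
      Differentiable ℝ (pressureFnReal T φ) ∧
      ∀ z, -entropyFn T φ z = ⨆ y, (((inner ℝ y z : ℝ) : EReal) - pressureFn T φ y)) ∧
    -- the case of an energy `F(μ(φ))`
    (∀ (U : Set (EuclideanSpace ℝ (Fin d))) (F : EuclideanSpace ℝ (Fin d) → ℝ),
      IsOpen U → rotationSet T φ ⊆ U → ContDiffOn ℝ r F U →
      (maximizers T φ (ofEnergy F)).Nonempty ∧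
      IsCompact (maximizers T φ (ofEnergy F)) ∧
      maximizers T φ (ofEnergy F) ⊆ interior (rotationSet T φ) ∧
      (∀ z ∈ maximizers T φ (ofEnergy F),
        gradient F z + gradient (entropyFnReal T φ) z = 0) ∧
      (slopes T φ (ofEnergy F)).Nonempty ∧
      IsCompact (slopes T φ (ofEnergy F)) ∧
      slopes T φ (ofEnergy F) =
        gradient (pressureFnReal T φ) ⁻¹' maximizers T φ (ofEnergy F) ∧
      nonlinearEquilibriumMeasures T φ (ofEnergy F) =
        ⋃ y ∈ slopes T φ (ofEnergy F), linearEquilibriumMeasures T (dotPotential φ y)) ∧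
    -- the case of a fully nonlinear pressure `G(h(T, μ); μ(φ))`
    (∀ (V : Set (ℝ × EuclideanSpace ℝ (Fin d))) (G : ℝ × EuclideanSpace ℝ (Fin d) → ℝ),
      IsOpen V → ContDiffOn ℝ r G V → (∀ p ∈ V, 0 < partialZero G p) →
      entropyMean T φ '' invariantMeasures T ⊆ V →
      closure (graphPoint T φ '' rotationSet T φ) ⊆ V →
      (maximizers T φ G).Nonempty ∧
      IsCompact (maximizers T φ G) ∧
      maximizers T φ G ⊆ interior (rotationSet T φ) ∧
      (∀ z ∈ maximizers T φ G,
        spatialGradient G (graphPoint T φ z) +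
          partialZero G (graphPoint T φ z) • gradient (entropyFnReal T φ) z = 0) ∧
      (slopes T φ G).Nonempty ∧
      IsCompact (slopes T φ G) ∧
      slopes T φ G = gradient (pressureFnReal T φ) ⁻¹' maximizers T φ G ∧
      nonlinearEquilibriumMeasures T φ G =
        (⋃ y ∈ slopes T φ G, linearEquilibriumMeasures T (dotPotential φ y)) ∧
      -- if linear equilibrium measures exist, the maximizers are the equilibrium values
      ((∀ y ∈ slopes T φ G, (linearEquilibriumMeasures T (dotPotential φ y)).Nonempty) →
        (nonlinearEquilibriumMeasures T φ G).Nonempty ∧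
        meanVector φ '' nonlinearEquilibriumMeasures T φ G = maximizers T φ G) ∧
      -- if the linear equilibrium measures are unique
      (∀ ν : EuclideanSpace ℝ (Fin d) → ProbabilityMeasure X,
        (∀ y, linearEquilibriumMeasures T (dotPotential φ y) = {ν y}) →
        nonlinearEquilibriumMeasures T φ G = ν '' slopes T φ G) ∧
      -- if the entropy is upper semicontinuous
      (UpperSemicontinuousOn (fun μ : ProbabilityMeasure X => ksEntropy T (μ : Measure X))
          (invariantMeasures T) →
        (nonlinearEquilibriumMeasures T φ G).Nonempty ∧
        IsCompact (nonlinearEquilibriumMeasures T φ G) ∧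
        meanVector φ '' nonlinearEquilibriumMeasures T φ G = maximizers T φ G)) := by
  have hL := hT.isLegendreOn hr
  refine ⟨⟨fun y => ?_, ?_, hT.neg_entropyFn_eq hr⟩, ?_, ?_⟩
  · rw [hT.pressureFn_eq hr]
    exact ⟨EReal.coe_ne_bot _, EReal.coe_ne_top _⟩
  · rw [hT.pressureFnReal_eq hr]
    exact fun y => (hL.hasGradientAt_tiltSup y).differentiableAt
  · intro U F hU hρU hF
    have hG := isMonotoneEnergy_ofEnergy hU (hF.of_le hr)
    have hVm : entropyMean T φ '' invariantMeasures T ⊆ Set.univ ×ˢ U := by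
      rintro _ ⟨μ, hμ, rfl⟩
      exact ⟨trivial, hρU ⟨μ, hμ, rfl⟩⟩
    -- The closure of the graph still projects into `ρ`, so an open `U ⊇ ρ` is enough in the energy
    -- case.
    have hVg : closure (graphPoint T φ '' rotationSet T φ) ⊆ Set.univ ×ˢ U := fun p hp =>
      ⟨trivial, hρU (hL.mem_and_le_of_mem_closure_valueGraph (s := p.1) hp).1⟩
    have hne : (maximizers T φ (ofEnergy F)).Nonempty := hL.graphMaximizers_nonempty hG hVg
    refine ⟨hne, hL.isCompact_graphMaximizers hG hVg, hL.graphMaximizers_subset_interior hG hVg,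
      fun z hz => ?_, hne.image _, hT.isCompact_slopes hr hG hVg, hT.slopes_eq hr hG hVg,
      hT.nonlinearEquilibriumMeasures_eq hr hG hVm hVg⟩
    have h : spatialGradient (ofEnergy F) (graphPoint T φ z) +
        partialZero (ofEnergy F) (graphPoint T φ z) • gradient (entropyFnReal T φ) z = 0 :=
      hL.gradient_eq_zero_of_mem_graphMaximizers hG hVg hz
    rwa [spatialGradient_ofEnergy, partialZero_ofEnergy, one_smul] at h
  · intro V G hV hGV hpos hVm hVg
    have hG : IsMonotoneEnergy V G := ⟨hV, hGV.of_le hr, hpos⟩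
    have hne : (maximizers T φ G).Nonempty := hL.graphMaximizers_nonempty hG hVg
    have himg := hT.image_meanVector_eq hr hG hVm hVg
    refine ⟨hne, hL.isCompact_graphMaximizers hG hVg, hL.graphMaximizers_subset_interior hG hVg,
      fun z hz => hL.gradient_eq_zero_of_mem_graphMaximizers hG hVg hz, hne.image _,
      hT.isCompact_slopes hr hG hVg, hT.slopes_eq hr hG hVg,
      hT.nonlinearEquilibriumMeasures_eq hr hG hVm hVg, himg, fun ν hν => ?_, fun hu => ?_⟩
    · rw [hT.nonlinearEquilibriumMeasures_eq hr hG hVm hVg]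
      simp only [hν]
      ext μ
      simp [eq_comm]
    · have h := himg fun y _ => hT.linearEquilibriumMeasures_nonempty hu y
      exact ⟨h.1, hT.isCompact_nonlinearEquilibriumMeasures hr hG hVm hVg hu, h.2⟩
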